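/- Let $n\ge 1$ and let $\pi=\pi_1\cdots\pi_n$ be an irreducible permutation of $[n]=\{1,\dots,n\}$, i.e. for no $1\le k<n$ is $\pi_1\cdots\pi_k$ a permutation of $[k]$. Let $G_\pi$ be its permutation graph: the vertex set is $[n]$, and letters $i>j$ are adjacent if and only if $i$ appears to the left of $j$ in the word $\pi$. Let $s\in[n]$ be any vertex. Then the following three sets are equinumerous. 1. The set $\mathrm{CNAT}(\pi)$ of complete non-ambiguous trees whose associated permutation is $\pi$. Here a non-ambiguous tree is a set of dotted cells of a rectangular grid such that every row and every column contains a dot and every dot outside the top-left cell has either a dot above it in its column or a dot to its left in its row, but not both. It is complete if every dot has both a dot below it in its column and a dot to its right in its row, or neither; the dots with neither are its leaf dots. It has associated permutation $\pi$ if the grid is $n\times n$ and the leaf dots are exactly the cells in column $i$ and row $\pi_i$, $1\le i\le n$ (columns are numbered from left to right, rows from top to bottom). 2. The set of minimal recurrent configurations of the Abelian sandpile model on $G_\pi$ with sink $s$. Here a configuration is a vector $c=(c_v)_{v\neq s}$ of non-negative integers; a vertex $v\ne s$ is stable if $c_v<\deg(v)$, and otherwise may topple, sending one grain to each of its neighbours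 (grains sent to $s$ are lost). The stabilisation of $c$ is the stable configuration reached by toppling unstable vertices successively. Fix any probability distribution $\mu$ on the non-sink vertices with $\mu_v>0$ for all $v\ne s$. A stable configuration is recurrent if it is a recurrent state of the Markov chain which at each step adds a grain at a random vertex of law $\mu$, independently of the past, and stabilises (if $n=1$, the only configuration, which is empty, counts as recurrent). It is minimal recurrent if it is minimal among the recurrent configurations for the componentwise order. 3. The set of $s$-rooted acyclic orientations of $G_\pi$: the orientations of the edges of $G_\pi$ without directed cycle for which $s$ is the only vertex all of whose edges are incoming. -/

import Mathlib

/-! ### Permutations and their graphs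

An `n`-permutation is an element of `Equiv.Perm (Fin n)`; its one-line notation is the word
`π 0, π 1, …, π (n - 1)`, with letters shifted down by one. -/

/-- `π` is irreducible: no proper nonempty prefix `π 0, …, π (k - 1)` of its one-line notation is a
permutation of the letters `0, …, k - 1`. -/
def PermIrreducible {n : ℕ} (π : Equiv.Perm (Fin n)) : Prop :=
  ¬ ∃ k : ℕ, 1 ≤ k ∧ k < n ∧ ∀ i : Fin n, (i : ℕ) < k → (π i : ℕ) < k

/-- The pair of letters `(i, j)` is an inversion of `π`: `i > j`, and `i` appears to the left of `j`
in the one-line notation of `π`. -/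
def IsInversion {n : ℕ} (π : Equiv.Perm (Fin n)) (i j : Fin n) : Prop :=
  j < i ∧ π.symm i < π.symm j

instance {n : ℕ} (π : Equiv.Perm (Fin n)) (i j : Fin n) : Decidable (IsInversion π i j) :=
  inferInstanceAs (Decidable (_ ∧ _))

/-- The permutation graph: vertices are the letters, edges are the inversions. -/
def permGraph {n : ℕ} (π : Equiv.Perm (Fin n)) : SimpleGraph (Fin n) where
  Adj i j := IsInversion π i j ∨ IsInversion π j i
  symm := ⟨fun _ _ h => h.symm⟩
  loopless := ⟨fun i h => by
    rcases h with h | h <;> exact lt_irrefl i h.1⟩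

instance {n : ℕ} (π : Equiv.Perm (Fin n)) : DecidableRel (permGraph π).Adj :=
  fun _ _ => inferInstanceAs (Decidable (_ ∨ _))

/-! ### Complete non-ambiguous trees

A filling of an `m × n` grid is the set of its dotted cells `(row, column)`; rows are numbered from
top to bottom and columns from left to right. -/

/-- There is a dot above the cell `p`, in the same column. -/
def DotAbove {m n : ℕ} (T : Set (Fin m × Fin n)) (p : Fin m × Fin n) : Prop :=
  ∃ r : Fin m, r < p.1 ∧ (r, p.2) ∈ T

/-- There is a dot to the left of the cell `p`, in the same row. -/
def DotLeft {m n : ℕ} (T : Set (Fin m × Fin n)) (p : Fin m × Fin n) : Prop :=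
  ∃ c : Fin n, c < p.2 ∧ (p.1, c) ∈ T

/-- There is a dot below the cell `p`, in the same column. -/
def DotBelow {m n : ℕ} (T : Set (Fin m × Fin n)) (p : Fin m × Fin n) : Prop :=
  ∃ r : Fin m, p.1 < r ∧ (r, p.2) ∈ T

/-- There is a dot to the right of the cell `p`, in the same row. -/
def DotRight {m n : ℕ} (T : Set (Fin m × Fin n)) (p : Fin m × Fin n) : Prop :=
  ∃ c : Fin n, p.2 < c ∧ (p.1, c) ∈ T

/-- Non-ambiguous trees on the `m × n` grid. -/
structure IsNAT {m n : ℕ} (T : Set (Fin m × Fin n)) : Prop where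
  row_nonempty : ∀ r : Fin m, ∃ c : Fin n, (r, c) ∈ T
  col_nonempty : ∀ c : Fin n, ∃ r : Fin m, (r, c) ∈ T
  unique_parent : ∀ p ∈ T, ¬ ((p.1 : ℕ) = 0 ∧ (p.2 : ℕ) = 0) → Xor (DotAbove T p) (DotLeft T p)

/-- Complete non-ambiguous trees: every dot has both a dot below it in its column and a dot to its
right in its row, or neither. -/
structure IsCNAT {m n : ℕ} (T : Set (Fin m × Fin n)) : Prop extends IsNAT T where
  complete : ∀ p ∈ T, DotBelow T p ↔ DotRight T p

/-- The leaf dots: those with no dot below in the same column and no dot to the right in the same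
row. -/
def leafDots {m n : ℕ} (T : Set (Fin m × Fin n)) : Set (Fin m × Fin n) :=
  {p | p ∈ T ∧ ¬ DotBelow T p ∧ ¬ DotRight T p}

/-- The graphical representation of `π`: a dot in column `i` and row `π i`, for every `i`. -/
def permDots {n : ℕ} (π : Equiv.Perm (Fin n)) : Set (Fin n × Fin n) :=
  {p | p.1 = π p.2}

/-- The CNATs with associated permutation `π`. -/
def cnatSet {n : ℕ} (π : Equiv.Perm (Fin n)) : Set (Set (Fin n × Fin n)) :=
  {T | IsCNAT T ∧ leafDots T = permDots π}

/-! ### Rooted acyclic orientations -/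

section Orientations

variable {V : Type*}

/-- `O` is an orientation of `G`: every edge of `G` gets exactly one of its two directions, and `O`
has no other arcs. -/
def IsOrientationOf (G : SimpleGraph V) (O : Digraph V) : Prop :=
  (∀ v w, O.Adj v w → G.Adj v w) ∧ ∀ v w, G.Adj v w → Xor (O.Adj v w) (O.Adj w v)

/-- No directed cycle. -/
def IsAcyclicOrientation (O : Digraph V) : Prop :=
  ∀ v, ¬ Relation.TransGen O.Adj v v

/-- `v` is a target: all the edges at `v` are incoming. -/
def IsTarget (G : SimpleGraph V) (O : Digraph V) (v : V) : Prop :=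
  ∀ w, G.Adj v w → O.Adj w v

/-- The `s`-rooted acyclic orientations of `G`: those whose unique target is `s`. -/
def rootedAcyclicOrientations (G : SimpleGraph V) (s : V) : Set (Digraph V) :=
  {O | IsOrientationOf G O ∧ IsAcyclicOrientation O ∧ ∀ v, IsTarget G O v ↔ v = s}

end Orientations

/-! ### The Abelian sandpile model on `(G, s)` -/

section Sandpile

variable {V : Type*} [Fintype V] [DecidableEq V]

/-- The non-sink vertices. -/
abbrev NonSink (s : V) : Type _ := {v : V // v ≠ s}

/-- A configuration: a number of grains on every non-sink vertex. -/
abbrev SandConfig (s : V) : Type _ := NonSink s → ℕ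

/-- One grain at the vertex `v`; this is the zero configuration if `v` is the sink. -/
def grain (s v : V) : SandConfig s := fun w => if (w : V) = v then 1 else 0

variable (G : SimpleGraph V) [DecidableRel G.Adj] (s : V)

/-- All the non-sink vertices are stable. -/
def IsStableConfig (c : SandConfig s) : Prop := ∀ v : NonSink s, c v < G.degree v

/-- Toppling the vertex `v`. Subtraction in `ℕ` is harmless, since only unstable vertices, those
with `G.degree v ≤ c v`, get toppled. -/
def topple (v : NonSink s) (c : SandConfig s) : SandConfig s :=
  c - G.degree (v : V) • grain s (v : V) + ∑ w ∈ G.neighborFinset (v : V), grain s w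

/-- `c'` arises from `c` by toppling one unstable vertex. -/
def ToppleStep (c c' : SandConfig s) : Prop :=
  ∃ v : NonSink s, G.degree (v : V) ≤ c v ∧ c' = topple G s v c

/-- `c'` is a stable configuration that arises from `c` by successively toppling unstable
vertices. -/
def IsStabilisation (c c' : SandConfig s) : Prop :=
  Relation.ReflTransGen (ToppleStep G s) c c' ∧ IsStableConfig G s c'

open Classical in
/-- The stabilisation of `c`. On a connected graph, the only kind of graph considered here, there
is exactly one `c'` with `IsStabilisation G s c c'`. -/
noncomputable def stab (c : SandConfig s) : SandConfig s :=
  if h : ∃ c', IsStabilisation G s c c' then h.choose else c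

/-- The run of the sandpile chain from `c` when the `k`-th grain is dropped on `ω k`: at each step a
grain is added and the result is stabilised. -/
noncomputable def sandRun (c : SandConfig s) (ω : ℕ → NonSink s) : ℕ → SandConfig s
  | 0 => c
  | k + 1 => stab G s (sandRun c ω k + grain s (ω k : V))

/-- A stable configuration is recurrent for the sandpile Markov chain, in which the grains are
dropped independently with law `μ`, if the chain started from it almost surely visits it infinitely
often. If there is no non-sink vertex, the condition is void, and the unique (empty) configuration
is recurrent. -/
def IsRecurrentConfig [MeasurableSpace V] (μ : MeasureTheory.Measure (NonSink s))
    (c : SandConfig s) : Prop :=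
  IsStableConfig G s c ∧
    ∀ᵐ ω ∂(MeasureTheory.Measure.infinitePi (fun _ : ℕ => μ)),
      ∃ᶠ k in Filter.atTop, sandRun G s c ω k = c

/-- The minimal recurrent configurations, for the pointwise order. -/
def minRec [MeasurableSpace V] (μ : MeasureTheory.Measure (NonSink s)) : Set (SandConfig s) :=
  {c | Minimal (IsRecurrentConfig G s μ) c}

end Sandpile

/-! Trees and minimal recurrent configurations are each compared with the `s`-rooted acyclic
orientations.

A dot of a CNAT that is not a leaf lies above the leaf of its column and to the left of the leaf of
its row, so its cell `(r, c)` is an inversion: an edge between the letters `r` and `π c`. A CNAT is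
thus a set `X` of edges. With the cells ordered lexicographically, row first, the CNATs are exactly
the `X` that connect all letters and contain no broken circuit (`withPermDots_mem_cnatSet_iff`). For
every order of the edges, such sets are as numerous as the rooted acyclic orientations, because
deletion and contraction of the largest edge give both numbers the same recurrence
(`sum_rootedAcyclic_eq_sum_isConnectedNBC`). Only the cardinalities are compared; the resulting
bijection is not explicit.

Minimal recurrent configurations are the indegree vectors of rooted acyclic orientations. Each such
vector can be reached from every stable configuration, so it is recurrent
(`isRecurrentConfig_indegConfig`); each recurrent configuration dominates one, read off from the
times of last toppling (`exists_indegConfig_le`); comparable vectors come from the same orientation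
(`eq_of_indegConfig_le`). Irreducibility of `π` makes the graph connected, so that stabilisation
terminates. -/

open Relation

/-! ### Deletion and contraction for rooted acyclic orientations. -/

section DeletionContraction

variable {V : Type*}

/-- The relation `S` with the extra arc `p → q`. -/
def AddArc (S : V → V → Prop) (p q x y : V) : Prop := S x y ∨ (x = p ∧ y = q)

theorem reflTransGen_mono {R S : V → V → Prop} (h : ∀ x y, R x y → S x y) {x y : V}
    (hxy : ReflTransGen R x y) : ReflTransGen S x y :=
  ReflTransGen.mono h x y hxy

theorem reflTransGen_symm {R : V → V → Prop} (hR : ∀ x y, R x y → R y x) {x y : V}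
    (h : ReflTransGen R x y) : ReflTransGen R y x := by
  induction h with
  | refl => exact .refl
  | tail _ h ih => exact .head (hR _ _ h) ih

/-- Of a walk through the new arc, only the parts before its first and after its last use matter. -/
theorem reflTransGen_addArc {S : V → V → Prop} {p q x y : V} :
    ReflTransGen (AddArc S p q) x y ↔
      ReflTransGen S x y ∨ (ReflTransGen S x p ∧ ReflTransGen S q y) := by
  constructor
  · intro h
    induction h with
    | refl => exact Or.inl .refl
    | tail _ h ih =>
      rcases h with h | ⟨rfl, rfl⟩
      · exact ih.imp (fun i => i.tail h) (fun i => ⟨i.1, i.2.tail h⟩)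
      · exact Or.inr ⟨ih.elim id And.left, .refl⟩
  · have mono : ∀ {u v}, ReflTransGen S u v → ReflTransGen (AddArc S p q) u v :=
      fun h => reflTransGen_mono (fun _ _ => Or.inl) h
    rintro (h | ⟨h, h'⟩)
    · exact mono h
    · exact ((mono h).tail (Or.inr ⟨rfl, rfl⟩)).trans (mono h')

/-- No arc of `K` lies on a directed cycle of `S`, and `s` can be reached from everywhere in `S`. -/
def RootedAcyclic (s : V) (K S : V → V → Prop) : Prop :=
  (∀ x y, K x y → ¬ ReflTransGen S y x) ∧ ∀ x, ReflTransGen S x s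

variable {s : V} {R K S : V → V → Prop} {p q : V}

/-- Here `R` stands for the contracted edges and `K` for the oriented ones; acyclicity constrains
only `K`. -/
theorem reflTransGen_exists_arc (hS : ∀ x y, S x y → R x y ∨ K x y) {x y : V}
    (h : ReflTransGen S x y) :
    ReflTransGen R x y ∨ ∃ u v, K u v ∧ ReflTransGen S x u ∧ ReflTransGen S v y := by
  induction h with
  | refl => exact Or.inl .refl
  | tail hx h ih =>
    rcases ih with ih | ⟨u, v, huv, hu, hv⟩
    · rcases hS _ _ h with h' | h'
      · exact Or.inl (ih.tail h')
      · exact Or.inr ⟨_, _, h', hx, .refl⟩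
    · exact Or.inr ⟨u, v, huv, hu, hv.tail h⟩

theorem rootedAcyclic_addArc_iff (hKS : ∀ x y, K x y → S x y) :
    RootedAcyclic s (AddArc K p q) (AddArc S p q) ↔
      (∀ x y, K x y → ¬ ReflTransGen S y x) ∧ ¬ ReflTransGen S q p ∧
        ∀ x, ReflTransGen S x s ∨ (ReflTransGen S x p ∧ ReflTransGen S q s) := by
  simp only [RootedAcyclic, reflTransGen_addArc]
  constructor
  · rintro ⟨h, h'⟩
    exact ⟨fun x y hxy hyx => h x y (Or.inl hxy) (Or.inl hyx),
      fun hqp => h p q (Or.inr ⟨rfl, rfl⟩) (Or.inl hqp), h'⟩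
  · rintro ⟨h, hqp, h'⟩
    refine ⟨?_, h'⟩
    rintro x y (hxy | ⟨rfl, rfl⟩)
    · rintro (hyx | ⟨hyp, hqx⟩)
      · exact h x y hxy hyx
      · exact hqp ((hqx.tail (hKS _ _ hxy)).trans hyp)
    · tauto

/-- Contracting `pq` means allowing both directions without adding to `K`. As `R` does not join `p`
and `q`, any walk of `S` between them uses an arc of `K` and closes up to a forbidden cycle. -/
theorem rootedAcyclic_contract_iff (hS : ∀ x y, S x y ↔ R x y ∨ K x y)
    (hpq : ¬ ReflTransGen R p q) (hqp : ¬ ReflTransGen R q p) :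
    RootedAcyclic s K (AddArc (AddArc S p q) q p) ↔
      (∀ x y, K x y → ¬ ReflTransGen S y x) ∧ ¬ ReflTransGen S q p ∧ ¬ ReflTransGen S p q ∧
        ∀ x, ReflTransGen S x s ∨ (ReflTransGen S x p ∧ ReflTransGen S q s) ∨
          (ReflTransGen S x q ∧ ReflTransGen S p s) := by
  have hKS : ∀ x y, K x y → S x y := fun x y h => (hS x y).2 (Or.inr h)
  have arc : ∀ {x y}, _ := @reflTransGen_exists_arc V R K S fun x y => (hS x y).1
  have key : ∀ x y, ReflTransGen (AddArc (AddArc S p q) q p) x y ↔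
      ReflTransGen S x y ∨ (ReflTransGen S x p ∧ ReflTransGen S q y) ∨
          (ReflTransGen S x q ∧ ReflTransGen S p y) := by
    intro x y
    simp only [reflTransGen_addArc]
    constructor
    · rintro ((h | ⟨h, h'⟩) | ⟨(h | ⟨h, -⟩), (h' | ⟨-, h'⟩)⟩)
      · exact Or.inl h
      · exact Or.inr (Or.inl ⟨h, h'⟩)
      · exact Or.inr (Or.inr ⟨h, h'⟩)
      · exact Or.inl (h.trans h')
      · exact Or.inl (h.trans h')
      · exact Or.inr (Or.inl ⟨h, h'⟩)
    · rintro (h | ⟨h, h'⟩ | ⟨h, h'⟩)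
      · exact Or.inl (Or.inl h)
      · exact Or.inl (Or.inr ⟨h, h'⟩)
      · exact Or.inr ⟨Or.inl h, Or.inl h'⟩
  simp only [RootedAcyclic, key]
  constructor
  · rintro ⟨h, h'⟩
    refine ⟨fun x y hxy hyx => h x y hxy (Or.inl hyx), fun g => ?_, fun g => ?_, h'⟩
    · obtain g | ⟨u, v, huv, hu, hv⟩ := arc g
      · exact hqp g
      · exact h u v huv (Or.inr (Or.inl ⟨hv, hu⟩))
    · obtain g | ⟨u, v, huv, hu, hv⟩ := arc g
      · exact hpq g
      · exact h u v huv (Or.inr (Or.inr ⟨hv, hu⟩))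
  · rintro ⟨h, h1, h2, h'⟩
    refine ⟨fun x y hxy => ?_, h'⟩
    have hxy' := hKS _ _ hxy
    rintro (g | ⟨g, g'⟩ | ⟨g, g'⟩)
    · exact h x y hxy g
    · exact h1 ((g'.tail hxy').trans g)
    · exact h2 ((g'.tail hxy').trans g)

-- If `S` has a walk between `p` and `q`, it has one in a single direction only: the contraction is
-- then cyclic, exactly one direction of the edge stays acyclic, and that arc does not affect
-- rootedness. With no such walk, acyclicity is automatic. If moreover `S` is not rooted, at most
-- one direction makes it so, and one does exactly when the contraction is rooted.
open Classical in
theorem rootedAcyclic_deletion_contraction (hS : ∀ x y, S x y ↔ R x y ∨ K x y)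
    (hpq : ¬ ReflTransGen R p q) (hqp : ¬ ReflTransGen R q p) :
    (if RootedAcyclic s (AddArc K p q) (AddArc S p q) then 1 else 0) +
      (if RootedAcyclic s (AddArc K q p) (AddArc S q p) then 1 else 0) =
    (if RootedAcyclic s K S then 1 else 0) +
      (if RootedAcyclic s K (AddArc (AddArc S p q) q p) then 1 else 0) := by
  have hKS : ∀ x y, K x y → S x y := fun x y h => (hS x y).2 (Or.inr h)
  have arc : ∀ {x y}, _ := @reflTransGen_exists_arc V R K S fun x y => (hS x y).1
  rw [rootedAcyclic_contract_iff hS hpq hqp, rootedAcyclic_addArc_iff hKS,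
    rootedAcyclic_addArc_iff hKS]
  unfold RootedAcyclic
  by_cases hA : ∀ x y, K x y → ¬ ReflTransGen S y x
  swap
  · rw [if_neg, if_neg, if_neg, if_neg] <;> exact fun h => hA h.1
  simp only [eq_true hA, true_and]
  by_cases h1 : ReflTransGen S q p
  · have h2 : ¬ ReflTransGen S p q := fun h2 => by
      obtain g | ⟨u, v, huv, hu, hv⟩ := arc h1
      · exact hqp g
      · exact hA u v huv (hv.trans (h2.trans hu))
    have : (∀ x, ReflTransGen S x s ∨ (ReflTransGen S x q ∧ ReflTransGen S p s)) ↔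
        ∀ x, ReflTransGen S x s :=
      forall_congr' fun x => or_iff_left_of_imp fun h => (h.1.trans h1).trans h.2
    simp [h1, h2, this]
  by_cases h2 : ReflTransGen S p q
  · have : (∀ x, ReflTransGen S x s ∨ (ReflTransGen S x p ∧ ReflTransGen S q s)) ↔
        ∀ x, ReflTransGen S x s :=
      forall_congr' fun x => or_iff_left_of_imp fun h => (h.1.trans h2).trans h.2
    simp [h1, h2, this]
  simp only [h1, h2, not_false_eq_true, true_and]
  by_cases hroot : ∀ x, ReflTransGen S x s
  · simp [hroot]
  obtain ⟨x₀, hx₀⟩ := not_forall.1 hroot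
  by_cases g1 : ∀ x, ReflTransGen S x s ∨ (ReflTransGen S x p ∧ ReflTransGen S q s)
  · have g2 : ¬ ∀ x, ReflTransGen S x s ∨ (ReflTransGen S x q ∧ ReflTransGen S p s) := by
      intro g2
      rcases g1 x₀ with h | ⟨h, -⟩
      · exact hx₀ h
      · rcases g2 x₀ with h' | ⟨-, h'⟩
        · exact hx₀ h'
        · exact hx₀ (h.trans h')
    have g3 : ∀ x, ReflTransGen S x s ∨ (ReflTransGen S x p ∧ ReflTransGen S q s) ∨
        (ReflTransGen S x q ∧ ReflTransGen S p s) := fun x => (g1 x).imp_right Or.inl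
    rw [if_pos g1, if_neg g2, if_neg hroot, if_pos g3]
  · by_cases g2 : ∀ x, ReflTransGen S x s ∨ (ReflTransGen S x q ∧ ReflTransGen S p s)
    · have g3 : ∀ x, ReflTransGen S x s ∨ (ReflTransGen S x p ∧ ReflTransGen S q s) ∨
        (ReflTransGen S x q ∧ ReflTransGen S p s) := fun x => (g2 x).imp_right Or.inr
      rw [if_neg g1, if_pos g2, if_neg hroot, if_pos g3]
    · have g3 : ¬ ∀ x, ReflTransGen S x s ∨ (ReflTransGen S x p ∧ ReflTransGen S q s) ∨
        (ReflTransGen S x q ∧ ReflTransGen S p s) := by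
        intro g3
        -- The direction in which `x₀` passes the edge is forced on every vertex: a vertex needing
        -- the opposite one would give `x₀` a walk to `s` in `S`.
        rcases g3 x₀ with h | ⟨h, h'⟩ | ⟨h, h'⟩
        · exact hx₀ h
        · refine g1 fun x => ?_
          rcases g3 x with k | k | ⟨-, k⟩
          · exact Or.inl k
          · exact Or.inr k
          · exact absurd (h.trans k) hx₀
        · refine g2 fun x => ?_
          rcases g3 x with k | ⟨-, k⟩ | k
          · exact Or.inl k
          · exact absurd (h.trans k) hx₀
          · exact Or.inr k
      rw [if_neg g1, if_neg g2, if_neg hroot, if_neg g3]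

end DeletionContraction

/-! ### Orientations and sets without broken circuits. -/

section BrokenCircuits

variable {V ε : Type*} (a b : ε → V)

/-- The arcs of the orientation in which an edge `f` of `E` is directed from `a f` to `b f` if it
belongs to `σ`, and from `b f` to `a f` otherwise. -/
def orientedArcs (E σ : Finset ε) (x y : V) : Prop :=
  ∃ f ∈ E, (f ∈ σ ∧ x = a f ∧ y = b f) ∨ (f ∉ σ ∧ x = b f ∧ y = a f)

/-- Adjacency by an edge of `X`. -/
def edgeLinks (X : Finset ε) (x y : V) : Prop :=
  ∃ f ∈ X, (x = a f ∧ y = b f) ∨ (x = b f ∧ y = a f)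

theorem edgeLinks_symm {X : Finset ε} {x y : V} (h : edgeLinks a b X x y) :
    edgeLinks a b X y x := by
  obtain ⟨f, hf, h⟩ := h
  exact ⟨f, hf, by tauto⟩

variable {a b} in
theorem reflTransGen_edgeLinks_symm {X : Finset ε} {x y : V}
    (h : ReflTransGen (edgeLinks a b X) x y) : ReflTransGen (edgeLinks a b X) y x :=
  reflTransGen_symm (fun _ _ => edgeLinks_symm a b) h

variable [LinearOrder ε]

/-- The edges of `X`, together with `R`, connect everything with `s` and contain no broken circuit,
that is, no path between the ends of an edge `f` of `E` all of whose edges are larger than `f`. -/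
def IsConnectedNBC (s : V) (E : Finset ε) (R : V → V → Prop) (X : Finset ε) : Prop :=
  (∀ v, ReflTransGen (R ⊔ edgeLinks a b X) v s) ∧
    ∀ f ∈ E, ¬ ReflTransGen (R ⊔ edgeLinks a b (X.filter (f < ·))) (a f) (b f)

theorem orientedArcs_insert {E σ : Finset ε} {e : ε} (hσ : e ∉ σ) :
    orientedArcs a b (insert e E) σ = AddArc (orientedArcs a b E σ) (b e) (a e) := by
  ext x y
  rw [orientedArcs, Finset.exists_mem_insert, or_comm]
  simp only [hσ, false_and, false_or, not_false_eq_true, true_and]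
  rfl

theorem orientedArcs_insert_insert {E σ : Finset ε} {e : ε} (hE : e ∉ E) :
    orientedArcs a b (insert e E) (insert e σ) = AddArc (orientedArcs a b E σ) (a e) (b e) := by
  ext x y
  rw [orientedArcs, Finset.exists_mem_insert, or_comm]
  simp only [Finset.mem_insert, true_or, true_and, not_true, false_and, or_false]
  refine or_congr_left (exists_congr fun f => and_congr_right fun hf => ?_)
  have : f ≠ e := fun h => hE (h ▸ hf)
  simp [this]

theorem sup_edgeLinks_insert (R : V → V → Prop) (X : Finset ε) (e : ε) :
    R ⊔ edgeLinks a b (insert e X) =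
      AddArc (AddArc R (a e) (b e)) (b e) (a e) ⊔ edgeLinks a b X := by
  ext x y
  simp only [AddArc, Pi.sup_apply, sup_Prop_eq]
  rw [edgeLinks, Finset.exists_mem_insert]
  simp only [or_assoc]
  rfl

theorem sup_addArc (R S : V → V → Prop) (p q : V) : R ⊔ AddArc S p q = AddArc (R ⊔ S) p q := by
  ext x y
  simp only [AddArc, Pi.sup_apply, sup_Prop_eq, or_assoc]

theorem addArc_sup (R S : V → V → Prop) (p q : V) : AddArc R p q ⊔ S = AddArc (R ⊔ S) p q := by
  rw [sup_comm, sup_addArc, sup_comm]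

variable {a b}

/-- No edge exceeds `e`, so the condition at `e` only says that `e` is not a loop after contracting
`R`. -/
theorem isConnectedNBC_insert {s : V} {E : Finset ε} {e : ε} (he : ∀ x ∈ E, x < e)
    (R : V → V → Prop) {X : Finset ε} (hX : X ⊆ E) :
    IsConnectedNBC a b s (insert e E) R X ↔
      ¬ ReflTransGen R (a e) (b e) ∧ IsConnectedNBC a b s E R X := by
  have : X.filter (e < ·) = ∅ :=
    Finset.filter_eq_empty_iff.2 fun x hx => (he x (hX hx)).not_gt
  have h0 : R ⊔ edgeLinks a b ∅ = R := by ext; simp [edgeLinks]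
  simp only [IsConnectedNBC, Finset.forall_mem_insert, this, h0]
  tauto

/-- Being larger than every other `f`, the edge `e` survives in all the filters and so acts as a
contracted edge. -/
theorem isConnectedNBC_insert_insert {s : V} {E : Finset ε} {e : ε} (he : ∀ x ∈ E, x < e)
    (R : V → V → Prop) {X : Finset ε} (hX : X ⊆ E) :
    IsConnectedNBC a b s (insert e E) R (insert e X) ↔
      ¬ ReflTransGen R (a e) (b e) ∧
        IsConnectedNBC a b s E (AddArc (AddArc R (a e) (b e)) (b e) (a e)) X := by
  have : (insert e X).filter (e < ·) = ∅ := by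
    rw [Finset.filter_eq_empty_iff, Finset.forall_mem_insert]
    exact ⟨lt_irrefl _, fun x hx => (he x (hX hx)).not_gt⟩
  have h0 : R ⊔ edgeLinks a b ∅ = R := by ext; simp [edgeLinks]
  have h1 : ∀ f ∈ E, (insert e X).filter (f < ·) = insert e (X.filter (f < ·)) := fun f hf => by
    rw [Finset.filter_insert, if_pos (he f hf)]
  simp only [IsConnectedNBC, Finset.forall_mem_insert, this, h0, sup_edgeLinks_insert]
  rw [and_left_comm]
  refine and_congr_right fun _ => and_congr_right fun _ => forall₂_congr fun f hf => ?_
  rw [h1 f hf, sup_edgeLinks_insert]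

open Classical in
/-- For every linear order on the edges, there are as many rooted acyclic orientations as connected
sets of edges without broken circuits. -/
theorem sum_rootedAcyclic_eq_sum_isConnectedNBC (s : V) (E : Finset ε) :
    ∀ R : V → V → Prop, (∀ x y, R x y → R y x) →
      ∑ σ ∈ E.powerset, (if RootedAcyclic s (orientedArcs a b E σ) (R ⊔ orientedArcs a b E σ)
        then 1 else 0) =
      ∑ X ∈ E.powerset, if IsConnectedNBC a b s E R X then 1 else 0 := by
  -- `R` stays general, since contracting the largest edge enlarges it.
  induction E using Finset.induction_on_max with
  | empty =>
    intro R _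
    have h0 : orientedArcs a b ∅ ∅ = ⊥ := by ext; simp [orientedArcs]
    have h1 : edgeLinks a b ∅ = ⊥ := by ext; simp [edgeLinks]
    rw [Finset.powerset_empty, Finset.sum_singleton, Finset.sum_singleton]
    simp [RootedAcyclic, IsConnectedNBC, h0, h1]
  | insert e E he ih =>
    intro R hR
    have heE : e ∉ E := fun h => lt_irrefl _ (he e h)
    rw [Finset.sum_powerset_insert heE, Finset.sum_powerset_insert heE,
      ← Finset.sum_add_distrib, ← Finset.sum_add_distrib]
    -- A loop `e` makes both sums zero: either direction lies on a cycle, and every `X` violates the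
    -- condition at `e`.
    by_cases hc : ReflTransGen R (a e) (b e)
    · have hc' : ReflTransGen R (b e) (a e) := reflTransGen_symm hR hc
      have mono : ∀ {S : V → V → Prop} {x y : V}, ReflTransGen R x y →
        ReflTransGen (R ⊔ S) x y := fun h => reflTransGen_mono (fun _ _ => Or.inl) h
      rw [Finset.sum_eq_zero, Finset.sum_eq_zero]
      · intro X hX
        rw [isConnectedNBC_insert he R (Finset.mem_powerset.1 hX),
          isConnectedNBC_insert_insert he R (Finset.mem_powerset.1 hX)]
        simp [hc]
      · intro σ hσ
        have hσe : e ∉ σ := fun h => heE (Finset.mem_powerset.1 hσ h)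
        rw [orientedArcs_insert a b hσe, orientedArcs_insert_insert a b heE, if_neg, if_neg, add_zero]
        · exact fun h => h.1 _ _ (Or.inr ⟨rfl, rfl⟩) (mono hc')
        · exact fun h => h.1 _ _ (Or.inr ⟨rfl, rfl⟩) (mono hc)
    · have hc' : ¬ ReflTransGen R (b e) (a e) := fun h => hc (reflTransGen_symm hR h)
      have hR' : ∀ x y, AddArc (AddArc R (a e) (b e)) (b e) (a e) x y →
          AddArc (AddArc R (a e) (b e)) (b e) (a e) y x := by
        intro x y
        have := hR x y
        simp only [AddArc]
        tauto
      trans ∑ σ ∈ E.powerset,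
        ((if RootedAcyclic s (orientedArcs a b E σ) (R ⊔ orientedArcs a b E σ) then 1 else 0) +
          if RootedAcyclic s (orientedArcs a b E σ)
            (AddArc (AddArc R (a e) (b e)) (b e) (a e) ⊔ orientedArcs a b E σ) then 1 else 0)
      · refine Finset.sum_congr rfl fun σ hσ => ?_
        have hσe : e ∉ σ := fun h => heE (Finset.mem_powerset.1 hσ h)
        rw [orientedArcs_insert a b hσe, orientedArcs_insert_insert a b heE, sup_addArc, sup_addArc,
          addArc_sup, addArc_sup, add_comm]
        exact rootedAcyclic_deletion_contraction (fun _ _ => Iff.rfl) hc hc'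
      · rw [Finset.sum_add_distrib, ih R hR, ih _ hR', ← Finset.sum_add_distrib]
        refine Finset.sum_congr rfl fun X hX => ?_
        rw [isConnectedNBC_insert he R (Finset.mem_powerset.1 hX),
          isConnectedNBC_insert_insert he R (Finset.mem_powerset.1 hX)]
        simp [hc]

end BrokenCircuits

/-! ### Dots without a parent. -/

section NonAmbiguousTrees

variable {m n : ℕ} {T : Set (Fin m × Fin n)}

/-- The dots `p` and `q` of `T` are in the same row or in the same column. -/
def InLine (T : Set (Fin m × Fin n)) (p q : Fin m × Fin n) : Prop :=
  p ∈ T ∧ q ∈ T ∧ (p.1 = q.1 ∨ p.2 = q.2)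

theorem InLine.symm {p q : Fin m × Fin n} (h : InLine T p q) : InLine T q p :=
  ⟨h.2.1, h.1, h.2.2.imp Eq.symm Eq.symm⟩

/-- The dots that can be reached from `p` by steps to the right and downwards. -/
inductive IsDescendant (T : Set (Fin m × Fin n)) (p : Fin m × Fin n) : Fin m × Fin n → Prop
  | refl : IsDescendant T p p
  | right {d d'} : IsDescendant T p d → d' ∈ T → d.1 = d'.1 → d.2 < d'.2 → IsDescendant T p d'
  | down {d d'} : IsDescendant T p d → d' ∈ T → d.2 = d'.2 → d.1 < d'.1 → IsDescendant T p d'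

theorem IsDescendant.mem {p d : Fin m × Fin n} (hp : p ∈ T) (h : IsDescendant T p d) : d ∈ T := by
  cases h with
  | refl => exact hp
  | right _ h => exact h
  | down _ h => exact h

theorem IsDescendant.le {p d : Fin m × Fin n} (h : IsDescendant T p d) :
    p.1 ≤ d.1 ∧ p.2 ≤ d.2 := by
  induction h with
  | refl => exact ⟨le_rfl, le_rfl⟩
  | right _ _ h h' ih => exact ⟨h ▸ ih.1, ih.2.trans h'.le⟩
  | down _ _ h h' ih => exact ⟨ih.1.trans h'.le, h ▸ ih.2⟩

/-- A dot `d` reached by a step to the right has a dot to its left, hence none above: its column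
only continues downwards, and its row is shared with the preceding dot, so induction applies. Steps
downwards are symmetric. -/
theorem IsDescendant.of_inLine (hT : ∀ p ∈ T, ¬ (DotAbove T p ∧ DotLeft T p))
    {p d : Fin m × Fin n} (hp : p ∈ T) (hpa : ¬ DotAbove T p) (hpl : ¬ DotLeft T p)
    (h : IsDescendant T p d) : ∀ q, InLine T d q → IsDescendant T p q := by
  induction h with
  | refl =>
    rintro ⟨r, c⟩ ⟨-, hq, h⟩
    rcases h with h | h
    · rcases lt_trichotomy p.2 c with h' | h' | h'
      · exact .right .refl hq h h'
      · rw [show (r, c) = p from Prod.ext h.symm h'.symm]; exact .refl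
      · exact absurd ⟨c, h', h ▸ hq⟩ hpl
    · rcases lt_trichotomy p.1 r with h' | h' | h'
      · exact .down .refl hq h h'
      · rw [show (r, c) = p from Prod.ext h'.symm h.symm]; exact .refl
      · exact absurd ⟨r, h', h ▸ hq⟩ hpa
  | @right e d he hd h1 h2 ih =>
    have hed : IsDescendant T p d := .right he hd h1 h2
    have heT := he.mem hp
    have hl : DotLeft T d := ⟨e.2, h2, h1 ▸ heT⟩
    rintro ⟨r, c⟩ ⟨-, hq, h⟩
    rcases h with h | h
    · exact ih _ ⟨heT, hq, Or.inl (h1.trans h)⟩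
    · rcases lt_trichotomy d.1 r with h' | h' | h'
      · exact .down hed hq h h'
      · rw [show (r, c) = d from Prod.ext h'.symm h.symm]; exact hed
      · exact absurd ⟨⟨r, h', h ▸ hq⟩, hl⟩ (hT d hd)
  | @down e d he hd h1 h2 ih =>
    have hed : IsDescendant T p d := .down he hd h1 h2
    have heT := he.mem hp
    have ha : DotAbove T d := ⟨e.1, h2, h1 ▸ heT⟩
    rintro ⟨r, c⟩ ⟨-, hq, h⟩
    rcases h with h | h
    · rcases lt_trichotomy d.2 c with h' | h' | h'
      · exact .right hed hq h h'
      · rw [show (r, c) = d from Prod.ext h.symm h'.symm]; exact hed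
      · exact absurd ⟨ha, ⟨c, h', h ▸ hq⟩⟩ (hT d hd)
    · exact ih _ ⟨heT, hq, Or.inr (h1.trans h)⟩

/-- If no dot of `T` has dots both above and to its left, then all the dots connected to a dot `p`
without dots above and to the left are to the south-east of `p`. -/
theorem le_of_reflTransGen_inLine (hT : ∀ p ∈ T, ¬ (DotAbove T p ∧ DotLeft T p))
    {p q : Fin m × Fin n} (hp : p ∈ T) (hpa : ¬ DotAbove T p) (hpl : ¬ DotLeft T p)
    (h : ReflTransGen (InLine T) p q) : p.1 ≤ q.1 ∧ p.2 ≤ q.2 := by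
  suffices IsDescendant T p q from this.le
  induction h with
  | refl => exact .refl
  | tail _ h ih => exact ih.of_inLine hT hp hpa hpl _ h

end NonAmbiguousTrees

/-! ### Complete non-ambiguous trees as edge sets without broken circuits. -/

section CompleteNonAmbiguousTrees

variable {n : ℕ} {π : Equiv.Perm (Fin n)}

/-- The letter of the row of the cell `f`. -/
def rowLetter (f : Fin n ×ₗ Fin n) : Fin n := (ofLex f).1

/-- The letter of the column of the cell `f`. -/
def colLetter (π : Equiv.Perm (Fin n)) (f : Fin n ×ₗ Fin n) : Fin n := π (ofLex f).2

/-- The cells that have a dot of `π` both below in their column and to the right in their row; they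
correspond to the inversions of `π`. -/
def inversionCells (π : Equiv.Perm (Fin n)) : Finset (Fin n ×ₗ Fin n) :=
  Finset.univ.filter fun f => (ofLex f).1 < π (ofLex f).2 ∧ (ofLex f).2 < π.symm (ofLex f).1

theorem mem_inversionCells {r c : Fin n} :
    toLex (r, c) ∈ inversionCells π ↔ r < π c ∧ c < π.symm r := by
  simp [inversionCells]

/-- The dots of `π` together with the cells in `X`. -/
def withPermDots (π : Equiv.Perm (Fin n)) (X : Finset (Fin n ×ₗ Fin n)) : Set (Fin n × Fin n) :=
  {p | toLex p ∈ X ∨ p.1 = π p.2}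

variable {X : Finset (Fin n ×ₗ Fin n)}

theorem mem_withPermDots {r c : Fin n} :
    (r, c) ∈ withPermDots π X ↔ toLex (r, c) ∈ X ∨ r = π c := Iff.rfl

theorem leaf_mem_withPermDots (v : Fin n) : (v, π.symm v) ∈ withPermDots π X :=
  Or.inr (π.apply_symm_apply v).symm

/-- A letter is represented by its leaf; a cell of `X` links the leaf of its row with that of its
column. -/
theorem inLine_of_edgeLinks {u v : Fin n}
    (h : ReflTransGen (edgeLinks rowLetter (colLetter π) X) u v) :
    ReflTransGen (InLine (withPermDots π X)) (u, π.symm u) (v, π.symm v) := by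
  have base : ∀ f ∈ X, ReflTransGen (InLine (withPermDots π X))
      (rowLetter f, π.symm (rowLetter f)) (colLetter π f, π.symm (colLetter π f)) := by
    intro f hf
    have hfT : ofLex f ∈ withPermDots π X := Or.inl hf
    refine (ReflTransGen.single (b := ofLex f) ?_).tail ?_
    · exact ⟨leaf_mem_withPermDots _, hfT, Or.inl rfl⟩
    · exact ⟨hfT, leaf_mem_withPermDots _, Or.inr (π.symm_apply_apply _).symm⟩
  induction h with
  | refl => exact .refl
  | tail _ h ih =>
    refine ih.trans ?_
    obtain ⟨f, hf, ⟨rfl, rfl⟩ | ⟨rfl, rfl⟩⟩ := h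
    · exact base f hf
    · exact reflTransGen_symm (fun _ _ => InLine.symm) (base f hf)

theorem edgeLinks_of_mem {r c : Fin n} (h : (r, c) ∈ withPermDots π X) :
    ReflTransGen (edgeLinks rowLetter (colLetter π) X) r (π c) := by
  rcases h with h | h
  · exact .single ⟨_, h, Or.inl ⟨rfl, rfl⟩⟩
  · rw [show r = π c from h]

variable {s : Fin n}

/-- Dots at `(r', c)`, `(r, c)`, `(r, c')` with `r' < r` and `c' < c` link the ends of the inversion
cell `(r', c')`, which precedes all three lexicographically: a broken circuit. -/
theorem not_dotAbove_and_dotLeft (hX : X ⊆ inversionCells π)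
    (h : IsConnectedNBC rowLetter (colLetter π) s (inversionCells π) ⊥ X) :
    ∀ p ∈ withPermDots π X,
      ¬ (DotAbove (withPermDots π X) p ∧ DotLeft (withPermDots π X) p) := by
  rintro ⟨r, c⟩ hp ⟨⟨r', hr, hp1⟩, ⟨c', hc, hp2⟩⟩
  dsimp only at hr hc hp1 hp2
  have hrc : r ≤ π c ∧ c ≤ π.symm r := by
    rcases hp with hp | hp
    · have := mem_inversionCells.1 (hX hp)
      exact ⟨this.1.le, this.2.le⟩
    · rw [show r = π c from hp]; simp
  have hp1 : toLex (r', c) ∈ X := hp1.resolve_right fun h => (hr.trans_le hrc.1).ne h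
  have hp2 : toLex (r, c') ∈ X := hp2.resolve_right fun h =>
    (hc.trans_le hrc.2).ne (π.symm_apply_eq.2 h).symm
  have h1 := mem_inversionCells.1 (hX hp1)
  have h2 := mem_inversionCells.1 (hX hp2)
  have hf : toLex (r', c') ∈ inversionCells π :=
    mem_inversionCells.2 ⟨hr.trans h2.1, hc.trans h1.2⟩
  have := h.2 _ hf
  rw [bot_sup_eq] at this
  set X' := X.filter (toLex (r', c') < ·)
  have m1 : toLex (r', c) ∈ X' := Finset.mem_filter.2
    ⟨hp1, Prod.Lex.toLex_lt_toLex.2 (Or.inr ⟨rfl, hc⟩)⟩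
  have m2 : toLex (r, c') ∈ X' := Finset.mem_filter.2
    ⟨hp2, Prod.Lex.toLex_lt_toLex.2 (Or.inl hr)⟩
  have m3 : (r, c) ∈ withPermDots π X' := hp.imp_left fun hp => Finset.mem_filter.2
    ⟨hp, Prod.Lex.toLex_lt_toLex.2 (Or.inl hr)⟩
  refine this ?_
  exact (edgeLinks_of_mem (Or.inl m1)).trans ((reflTransGen_edgeLinks_symm (edgeLinks_of_mem m3)).trans (edgeLinks_of_mem (Or.inl m2)))

theorem not_dotBelow_leaf (hX : X ⊆ inversionCells π) {r c : Fin n} (h : r = π c) :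
    ¬ DotBelow (withPermDots π X) (r, c) := by
  rintro ⟨r', hr, h' | h'⟩
  · exact lt_asymm hr (h ▸ (mem_inversionCells.1 (hX h')).1)
  · exact hr.ne (h.trans h'.symm)

theorem not_dotRight_leaf (hX : X ⊆ inversionCells π) {r c : Fin n} (h : r = π c) :
    ¬ DotRight (withPermDots π X) (r, c) := by
  rintro ⟨c', hc, h' | h'⟩
  · have := (mem_inversionCells.1 (hX h')).2
    rw [h, π.symm_apply_apply] at this
    exact lt_asymm hc this
  · exact hc.ne (π.injective (h.symm.trans h'))

theorem dotBelow_dotRight_cell (hX : X ⊆ inversionCells π) {r c : Fin n} (h : toLex (r, c) ∈ X) :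
    DotBelow (withPermDots π X) (r, c) ∧ DotRight (withPermDots π X) (r, c) := by
  have := mem_inversionCells.1 (hX h)
  exact ⟨⟨π c, this.1, Or.inr rfl⟩, ⟨π.symm r, this.2, leaf_mem_withPermDots r⟩⟩

/-- By connectedness, a parentless dot is weakly north-west of all leaves. Those of the first row
and the first column force it into the corner. -/
theorem withPermDots_mem_cnatSet (hX : X ⊆ inversionCells π)
    (h : IsConnectedNBC rowLetter (colLetter π) s (inversionCells π) ⊥ X) :
    withPermDots π X ∈ cnatSet π := by
  have hnb := not_dotAbove_and_dotLeft hX h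
  refine ⟨⟨⟨fun r => ⟨_, leaf_mem_withPermDots r⟩, fun c => ⟨π c, Or.inr rfl⟩, ?_⟩, ?_⟩, ?_⟩
  · rintro ⟨r, c⟩ hp h0
    rw [xor_iff_or_and_not_and]
    refine ⟨?_, hnb _ hp⟩
    by_contra hcon
    rw [not_or] at hcon
    have conn : ∀ v, ReflTransGen (InLine (withPermDots π X)) (r, c) (v, π.symm v) := by
      intro v
      have hrv : ReflTransGen (edgeLinks rowLetter (colLetter π) X) r v := by
        have := h.1
        rw [bot_sup_eq] at this
        exact (this r).trans (reflTransGen_edgeLinks_symm (this v))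
      exact .head ⟨hp, leaf_mem_withPermDots r, Or.inl rfl⟩ (inLine_of_edgeLinks hrv)
    have key := fun v => le_of_reflTransGen_inLine hnb hp hcon.1 hcon.2 (conn v)
    have hn : 0 < n := r.pos
    have k1 := (key ⟨0, hn⟩).1
    have k2 := (key (π ⟨0, hn⟩)).2
    rw [π.symm_apply_apply] at k2
    exact h0 ⟨Nat.le_zero.1 k1, Nat.le_zero.1 k2⟩
  · rintro ⟨r, c⟩ (hp | hp)
    · have := dotBelow_dotRight_cell hX hp
      exact iff_of_true this.1 this.2
    · exact iff_of_false (not_dotBelow_leaf hX hp) (not_dotRight_leaf hX hp)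
  · ext ⟨r, c⟩
    constructor
    · rintro ⟨hp | hp, h1, -⟩
      · exact absurd (dotBelow_dotRight_cell hX hp).1 h1
      · exact hp
    · exact fun hp => ⟨Or.inr hp, not_dotBelow_leaf hX hp, not_dotRight_leaf hX hp⟩

/-- Passing to the parent lowers the sum of the coordinates, until the corner is reached. -/
theorem edgeLinks_zero_of_isNAT (hT : IsNAT (withPermDots π X)) :
    ∀ (k : ℕ) (r c : Fin n), (r, c) ∈ withPermDots π X → (r : ℕ) + c = k →
      ReflTransGen (edgeLinks rowLetter (colLetter π) X) r ⟨0, r.pos⟩ := by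
  intro k
  induction k using Nat.strong_induction_on with
  | _ k ih =>
    intro r c hp hk
    by_cases h0 : (r : ℕ) = 0 ∧ (c : ℕ) = 0
    · rw [show r = ⟨0, r.pos⟩ from Fin.ext h0.1]
    · rcases ((xor_iff_or_and_not_and _ _).1 (hT.unique_parent _ hp h0)).1 with
        ⟨r', hr, hq⟩ | ⟨c', hc, hq⟩
      · have hr' : (r' : ℕ) < r := hr
        exact (edgeLinks_of_mem hp).trans ((reflTransGen_edgeLinks_symm
          (edgeLinks_of_mem hq)).trans (ih _ (by omega) r' c hq rfl))
      · have hc' : (c' : ℕ) < c := hc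
        exact ih _ (by omega) r c' hq rfl

/-- Suppose cells larger than `(r₀, c₀)` join its ends. Together with the leaves, they leave the
first dot of row `r₀` to the right of column `c₀`, with nothing above or to its left. All dots
connected to it are then south-east of it, yet the leaf of column `c₀` is not. -/
theorem isConnectedNBC_of_isNAT (s : Fin n) (hX : X ⊆ inversionCells π)
    (hT : IsNAT (withPermDots π X)) (hnb : ∀ p ∈ withPermDots π X,
      ¬ (DotAbove (withPermDots π X) p ∧ DotLeft (withPermDots π X) p)) :
    IsConnectedNBC rowLetter (colLetter π) s (inversionCells π) ⊥ X := by
  constructor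
  · intro v
    rw [bot_sup_eq]
    exact (edgeLinks_zero_of_isNAT hT _ v _ (leaf_mem_withPermDots v) rfl).trans
      (reflTransGen_edgeLinks_symm (edgeLinks_zero_of_isNAT hT _ s _ (leaf_mem_withPermDots s) rfl))
  · rintro f hf hconn
    rw [bot_sup_eq] at hconn
    obtain ⟨⟨r₀, c₀⟩, rfl⟩ := toLex.surjective f
    have hf' := mem_inversionCells.1 hf
    set X' := X.filter (toLex (r₀, c₀) < ·) with hX'
    have hX'X : X' ⊆ X := Finset.filter_subset _ _
    have hsub : withPermDots π X' ⊆ withPermDots π X := fun p => Or.imp_left fun h => hX'X h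
    have hnb' : ∀ p ∈ withPermDots π X',
        ¬ (DotAbove (withPermDots π X') p ∧ DotLeft (withPermDots π X') p) := by
      rintro p hp ⟨⟨r, hr, hq⟩, ⟨c, hc, hq'⟩⟩
      exact hnb p (hsub hp) ⟨⟨r, hr, hsub hq⟩, ⟨c, hc, hsub hq'⟩⟩
    obtain ⟨c, hc, hmin⟩ := WellFounded.has_min (wellFounded_lt (α := Fin n))
      {c | (r₀, c) ∈ withPermDots π X'} ⟨_, leaf_mem_withPermDots r₀⟩
    have hc₀ : c₀ < c := by
      rcases hc with hc | hc
      · have := (Finset.mem_filter.1 hc).2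
        rw [Prod.Lex.toLex_lt_toLex] at this
        exact (this.resolve_left (lt_irrefl _)).2
      · rw [show r₀ = π c from hc, π.symm_apply_apply] at hf'
        exact hf'.2
    have hrc : r₀ ≤ π c := by
      rcases hc with hc | hc
      · exact (mem_inversionCells.1 (hX (hX'X hc))).1.le
      · exact le_of_eq hc
    have habove : ¬ DotAbove (withPermDots π X') (r₀, c) := by
      rintro ⟨r, hr, hq | hq⟩
      · have := (Finset.mem_filter.1 hq).2
        rw [Prod.Lex.toLex_lt_toLex] at this
        rcases this with h | h
        · exact lt_asymm h hr
        · exact hr.ne h.1.symm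
      · exact (hr.trans_le hrc).ne hq
    have hleft : ¬ DotLeft (withPermDots π X') (r₀, c) := fun ⟨c', hc', hq⟩ => hmin c' hq hc'
    have key := (le_of_reflTransGen_inLine hnb' hc habove hleft (.head
      ⟨hc, leaf_mem_withPermDots r₀, Or.inl rfl⟩
      (inLine_of_edgeLinks hconn))).2
    rw [colLetter, ofLex_toLex, π.symm_apply_apply] at key
    exact hc₀.not_ge key

/-- By completeness, the lowest dot of a column and the last dot of a row are leaves. -/
theorem mem_inversionCells_of_mem_cnatSet {T : Set (Fin n × Fin n)} (hT : T ∈ cnatSet π)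
    {r c : Fin n} (h : (r, c) ∈ T) (hrc : r ≠ π c) : toLex (r, c) ∈ inversionCells π := by
  obtain ⟨hT, hleaf⟩ := hT
  have leaf : ∀ p ∈ T, ¬ DotBelow T p → p.1 = π p.2 := fun p hp hb => by
    have : p ∈ leafDots T := ⟨hp, hb, fun hr => hb ((hT.complete p hp).2 hr)⟩
    rw [hleaf] at this
    exact this
  have hb : DotBelow T (r, c) := by
    by_contra hb
    exact hrc (leaf _ h hb)
  have hr := (hT.complete _ h).1 hb
  rw [mem_inversionCells]
  constructor
  · obtain ⟨r', hr', hmax⟩ := WellFounded.has_min (wellFounded_gt (α := Fin n))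
      {r' | (r', c) ∈ T} ⟨r, h⟩
    have := leaf (r', c) hr' fun ⟨r'', h1, h2⟩ => hmax r'' h2 h1
    exact lt_of_le_of_ne (this ▸ not_lt.1 (hmax r h)) hrc
  · obtain ⟨c', hc', hmax⟩ := WellFounded.has_min (wellFounded_gt (α := Fin n))
      {c' | (r, c') ∈ T} ⟨c, h⟩
    have := leaf (r, c') hc' fun hb => by
      obtain ⟨c'', h1, h2⟩ := (hT.complete _ hc').1 hb
      exact hmax c'' h2 h1
    rw [show π.symm r = c' from π.symm_apply_eq.2 this]
    refine lt_of_le_of_ne (not_lt.1 (hmax c h)) ?_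
    rintro rfl
    exact hrc this

open Classical in
theorem withPermDots_filter {T : Set (Fin n × Fin n)} (hT : T ∈ cnatSet π) :
    withPermDots π ((inversionCells π).filter fun f => ofLex f ∈ T) = T := by
  ext ⟨r, c⟩
  rw [mem_withPermDots, Finset.mem_filter, ofLex_toLex]
  constructor
  · rintro (h | h)
    · exact h.2
    · have : (r, c) ∈ permDots π := h
      rw [← hT.2] at this
      exact this.1
  · intro h
    by_cases hrc : r = π c
    · exact Or.inr hrc
    · exact Or.inl ⟨mem_inversionCells_of_mem_cnatSet hT h hrc, h⟩

theorem withPermDots_mem_cnatSet_iff (s : Fin n) (hX : X ⊆ inversionCells π) :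
    withPermDots π X ∈ cnatSet π ↔
      IsConnectedNBC rowLetter (colLetter π) s (inversionCells π) ⊥ X := by
  refine ⟨fun h => isConnectedNBC_of_isNAT s hX h.1.toIsNAT ?_, withPermDots_mem_cnatSet hX⟩
  rintro ⟨r, c⟩ hp hboth
  by_cases h0 : (r : ℕ) = 0 ∧ (c : ℕ) = 0
  · obtain ⟨⟨r', hr, -⟩, -⟩ := hboth
    exact absurd (show (r' : ℕ) < r from hr) (by omega)
  · exact ((xor_iff_or_and_not_and _ _).1 (h.1.unique_parent _ hp h0)).2 hboth

open Classical in
/-- The complete non-ambiguous trees with permutation `π` correspond to the connected sets of edges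
of the graph of `π` without broken circuits. -/
noncomputable def cnatEquiv (π : Equiv.Perm (Fin n)) (s : Fin n) :
    cnatSet π ≃ {X // X ∈ (inversionCells π).powerset.filter fun X =>
      IsConnectedNBC rowLetter (colLetter π) s (inversionCells π) ⊥ X} where
  toFun T := ⟨(inversionCells π).filter fun f => ofLex f ∈ T.1, by
    rw [Finset.mem_filter, Finset.mem_powerset,
      ← withPermDots_mem_cnatSet_iff s (Finset.filter_subset _ _), withPermDots_filter T.2]
    exact ⟨Finset.filter_subset _ _, T.2⟩⟩
  invFun X := ⟨withPermDots π X.1, by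
    have := X.2
    rw [Finset.mem_filter, Finset.mem_powerset] at this
    exact withPermDots_mem_cnatSet this.1 this.2⟩
  left_inv T := Subtype.ext (withPermDots_filter T.2)
  right_inv X := by
    have hX := Finset.mem_powerset.1 (Finset.mem_filter.1 X.2).1
    refine Subtype.ext (Finset.ext fun f => ?_)
    obtain ⟨⟨r, c⟩, rfl⟩ := toLex.surjective f
    rw [Finset.mem_filter, ofLex_toLex, mem_withPermDots]
    constructor
    · rintro ⟨h, h' | h'⟩
      · exact h'
      · exact absurd h' (mem_inversionCells.1 h).1.ne
    · exact fun h => ⟨hX h, Or.inl h⟩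

end CompleteNonAmbiguousTrees

/-! ### Toppling and stabilisation. -/

section Toppling

variable {V : Type*} [Fintype V] [DecidableEq V] {G : SimpleGraph V} [DecidableRel G.Adj] {s : V}

theorem topple_apply (v w : NonSink s) (c : SandConfig s) :
    topple G s v c w =
      c w - (if w = v then G.degree v else 0) + if G.Adj v w then 1 else 0 := by
  simp [topple, grain, Finset.sum_apply, Subtype.ext_iff]

theorem topple_apply_self (v : NonSink s) (c : SandConfig s) :
    topple G s v c v = c v - G.degree v := by
  simp [topple_apply]

theorem topple_apply_of_ne {v w : NonSink s} (h : w ≠ v) (c : SandConfig s) :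
    topple G s v c w = c w + if G.Adj v w then 1 else 0 := by
  simp [topple_apply, h]

theorem ToppleStep.add {c c' : SandConfig s} (h : ToppleStep G s c c') (d : SandConfig s) :
    ToppleStep G s (c + d) (c' + d) := by
  obtain ⟨v, hv, rfl⟩ := h
  refine ⟨v, le_add_right hv, ?_⟩
  ext w
  by_cases hw : w = v
  · subst hw
    rw [Pi.add_apply, topple_apply_self, topple_apply_self, Pi.add_apply]
    omega
  · rw [Pi.add_apply, topple_apply_of_ne hw, topple_apply_of_ne hw, Pi.add_apply]
    omega

theorem reflTransGen_toppleStep_add {c c' : SandConfig s}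
    (h : ReflTransGen (ToppleStep G s) c c') (d : SandConfig s) :
    ReflTransGen (ToppleStep G s) (c + d) (c' + d) := by
  induction h with
  | refl => exact .refl
  | tail _ h ih => exact ih.tail (h.add d)

/-- Toppling one vertex never takes grains from another, so distinct unstable vertices can topple in
either order. -/
theorem ToppleStep.diamond {c c₁ c₂ : SandConfig s} (h₁ : ToppleStep G s c c₁)
    (h₂ : ToppleStep G s c c₂) :
    ∃ d, ReflGen (ToppleStep G s) c₁ d ∧ ReflTransGen (ToppleStep G s) c₂ d := by
  obtain ⟨v, hv, rfl⟩ := h₁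
  obtain ⟨w, hw, rfl⟩ := h₂
  by_cases hvw : v = w
  · subst hvw
    exact ⟨_, .refl, .refl⟩
  refine ⟨topple G s w (topple G s v c), .single ⟨w, ?_, rfl⟩, .single ⟨v, ?_, ?_⟩⟩
  · rw [topple_apply_of_ne (Ne.symm hvw)]
    omega
  · rw [topple_apply_of_ne hvw]
    omega
  · ext x
    by_cases hxv : x = v
    · subst hxv
      rw [topple_apply_of_ne hvw, topple_apply_self, topple_apply_self, topple_apply_of_ne hvw]
      omega
    by_cases hxw : x = w
    · subst hxw
      rw [topple_apply_self, topple_apply_of_ne hxv, topple_apply_of_ne hxv, topple_apply_self]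
      omega
    rw [topple_apply_of_ne hxw, topple_apply_of_ne hxv, topple_apply_of_ne hxv,
      topple_apply_of_ne hxw]
    omega

theorem IsStableConfig.eq_of_reflTransGen {c c' : SandConfig s} (hc : IsStableConfig G s c)
    (h : ReflTransGen (ToppleStep G s) c c') : c = c' := by
  rcases h.cases_head with h | ⟨_, ⟨v, hv, -⟩, -⟩
  · exact h
  · exact absurd (hc v) hv.not_gt

theorem IsStabilisation.unique {c c₁ c₂ : SandConfig s} (h₁ : IsStabilisation G s c c₁)
    (h₂ : IsStabilisation G s c c₂) : c₁ = c₂ := by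
  obtain ⟨d, hd₁, hd₂⟩ := church_rosser (fun _ _ _ => ToppleStep.diamond) h₁.1 h₂.1
  exact (h₁.2.eq_of_reflTransGen hd₁).trans (h₂.2.eq_of_reflTransGen hd₂).symm

/-- A strictly superharmonic function that vanishes at the sink. -/
theorem exists_superharmonic (hG : G.Connected) (s : V) :
    ∃ f : V → ℕ, f s = 0 ∧
      ∀ v, v ≠ s → ∑ w ∈ G.neighborFinset v, f w < G.degree v * f v := by
  set N := Finset.univ.sup fun v => G.dist v s with hN
  set B := Fintype.card V + 1 with hB
  have hdist : ∀ v, G.dist v s ≤ N := fun v =>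
    Finset.le_sup (f := fun v => G.dist v s) (Finset.mem_univ v)
  have hpow : ∀ v, B ^ N - B ^ (N - G.dist v s) + B ^ (N - G.dist v s) = B ^ N := fun v =>
    Nat.sub_add_cancel (Nat.pow_le_pow_right (Nat.succ_pos _) (Nat.sub_le _ _))
  -- With `P = B ^ (N - dist v s)`, a neighbour `w₀` nearer to the sink has value at most `B ^ N - B
  -- * P`, the others at most `B ^ N`. As `B` exceeds the degree, this one deficit suffices.
  refine ⟨fun v => B ^ N - B ^ (N - G.dist v s), by simp, fun v hv => ?_⟩
  obtain ⟨p, hp⟩ := hG.exists_walk_length_eq_dist v s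
  cases p with
  | nil => exact absurd rfl hv
  | @cons _ w₀ _ hadj p =>
    rw [SimpleGraph.Walk.length_cons] at hp
    have hw₀ : G.dist w₀ s + 1 ≤ G.dist v s := by
      have := SimpleGraph.dist_le p
      omega
    set P := B ^ (N - G.dist v s) with hP
    have hPpos : 0 < P := Nat.pow_pos (Nat.succ_pos _)
    have hBP : B * P ≤ B ^ (N - G.dist w₀ s) := by
      rw [hP, ← pow_succ']
      refine Nat.pow_le_pow_right (Nat.succ_pos _) ?_
      have := hdist v
      omega
    have hsum : ∑ w ∈ G.neighborFinset v,
        (B ^ N - B ^ (N - G.dist w s) + if w = w₀ then B * P else 0) ≤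
        ∑ w ∈ G.neighborFinset v, (B ^ N - P + P) := by
      refine Finset.sum_le_sum fun w _ => ?_
      rw [show B ^ N - P + P = B ^ N from hpow v]
      have := hpow w
      split_ifs with h
      · subst h
        omega
      · omega
    rw [Finset.sum_add_distrib, Finset.sum_ite_eq', if_pos ((G.mem_neighborFinset v w₀).2 hadj),
      Finset.sum_const, G.card_neighborFinset_eq_degree, smul_eq_mul] at hsum
    have hdeg : G.degree v < B := Nat.lt_succ_of_lt (G.degree_lt_card_verts v)
    have := Nat.mul_lt_mul_of_pos_right hdeg hPpos
    change ∑ w ∈ G.neighborFinset v, (B ^ N - B ^ (N - G.dist w s)) < G.degree v * (B ^ N - P)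
    rw [Nat.mul_sub]
    rw [Nat.mul_add, Nat.mul_sub] at hsum
    have : G.degree v * P ≤ G.degree v * B ^ N :=
      Nat.mul_le_mul_left _ (Nat.pow_le_pow_right (Nat.succ_pos _) (Nat.sub_le _ _))
    omega

theorem sum_subtype_adj {f : V → ℕ} (hf : f s = 0) (v : V) :
    ∑ w : NonSink s, f w * (if G.Adj v w then 1 else 0) = ∑ w ∈ G.neighborFinset v, f w := by
  have h1 : ∑ w ∈ G.neighborFinset v, f w = ∑ w, f w * (if G.Adj v w then 1 else 0) := by
    rw [G.neighborFinset_eq_filter, Finset.sum_filter]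
    exact Finset.sum_congr rfl fun w _ => by simp
  rw [h1, ← Finset.sum_erase_add _ _ (Finset.mem_univ s), hf, zero_mul, add_zero]
  exact (Finset.sum_subtype (Finset.univ.erase s) (by simp)
    fun w => f w * if G.Adj v w then 1 else 0).symm

/-- Weighting grains by a strictly superharmonic function, every toppling lowers the total weight.
-/
theorem exists_isStabilisation (hG : G.Connected) (c : SandConfig s) :
    ∃ c', IsStabilisation G s c c' := by
  obtain ⟨f, hfs, hf⟩ := exists_superharmonic hG s
  induction hk : ∑ w : NonSink s, f w * c w using Nat.strong_induction_on generalizing c with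
  | _ k ih =>
    by_cases hc : IsStableConfig G s c
    · exact ⟨c, .refl, hc⟩
    obtain ⟨v, hv⟩ := not_forall.1 hc
    rw [not_lt] at hv
    have key : ∑ w : NonSink s, f w * topple G s v c w + G.degree v * f v =
        ∑ w : NonSink s, f w * c w + ∑ w ∈ G.neighborFinset (v : V), f w := by
      rw [← sum_subtype_adj hfs, ← Finset.sum_add_distrib]
      have : G.degree v * f v = ∑ w : NonSink s, if w = v then G.degree v * f v else 0 := by simp
      rw [this, ← Finset.sum_add_distrib]
      refine Finset.sum_congr rfl fun w _ => ?_
      by_cases hw : w = v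
      · subst hw
        rw [topple_apply_self, if_pos rfl, if_neg G.irrefl, mul_zero, add_zero, mul_comm _ (f w),
          ← mul_add, Nat.sub_add_cancel hv]
      · rw [topple_apply_of_ne hw, if_neg hw, mul_add, add_zero]
    have := hf v v.2
    obtain ⟨c', h, h'⟩ := ih (∑ w : NonSink s, f w * topple G s v c w) (by omega) _ rfl
    exact ⟨c', .head ⟨v, hv, rfl⟩ h, h'⟩

theorem isStabilisation_stab (hG : G.Connected) (c : SandConfig s) :
    IsStabilisation G s c (stab G s c) := by
  have h := exists_isStabilisation hG c
  rw [stab, dif_pos h]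
  exact h.choose_spec

/-- The result of adding the grains of the word `W` one after another, stabilising each time. -/
noncomputable def wordRun (G : SimpleGraph V) [DecidableRel G.Adj] (c : SandConfig s)
    (W : List (NonSink s)) : SandConfig s :=
  W.foldl (fun d v => stab G s (d + grain s (v : V))) c

theorem wordRun_append_singleton (c : SandConfig s) (W : List (NonSink s)) (v : NonSink s) :
    wordRun G c (W ++ [v]) = stab G s (wordRun G c W + grain s (v : V)) := by
  simp [wordRun]

theorem wordRun_append (c : SandConfig s) (W W' : List (NonSink s)) :
    wordRun G c (W ++ W') = wordRun G (wordRun G c W) W' := by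
  simp [wordRun]

theorem isStableConfig_wordRun (hG : G.Connected) {c : SandConfig s} (hc : IsStableConfig G s c)
    (W : List (NonSink s)) : IsStableConfig G s (wordRun G c W) := by
  induction W using List.reverseRecOn with
  | nil => exact hc
  | append_singleton W v _ =>
    rw [wordRun_append_singleton]
    exact (isStabilisation_stab hG _).2

/-- Topplings remain legal when later grains are present from the start. -/
theorem reflTransGen_wordRun (hG : G.Connected) (c : SandConfig s) (W : List (NonSink s)) :
    ReflTransGen (ToppleStep G s) (c + (W.map fun v : NonSink s => grain s (v : V)).sum) (wordRun G c W) := by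
  induction W using List.reverseRecOn with
  | nil => simpa [wordRun] using ReflTransGen.refl
  | append_singleton W v ih =>
    rw [wordRun_append_singleton, List.map_append, List.sum_append, List.map_singleton,
      List.sum_singleton, ← add_assoc]
    exact (reflTransGen_toppleStep_add ih (grain s (v : V))).trans (isStabilisation_stab hG _).1

theorem exists_word_sum (x : SandConfig s) :
    ∃ W : List (NonSink s), (W.map fun v : NonSink s => grain s (v : V)).sum = x := by
  set m : Multiset (NonSink s) := Finset.univ.val.bind fun v => Multiset.replicate (x v) v
  refine ⟨m.toList, ?_⟩
  rw [← Multiset.sum_coe, ← Multiset.map_coe, Multiset.coe_toList, Multiset.map_bind,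
    Multiset.sum_bind]
  simp only [Multiset.map_replicate, Multiset.sum_replicate]
  change ∑ v : NonSink s, x v • grain s (v : V) = x
  ext w
  simp [grain, Finset.sum_apply, ← Subtype.ext_iff]

theorem sandRun_add_eq_wordRun {c : SandConfig s} {ω : ℕ → NonSink s} {k : ℕ}
    {W : List (NonSink s)} (hW : ∀ (i : ℕ) (h : i < W.length), ω (k + i) = W[i]) :
    ∀ j ≤ W.length, sandRun G s c ω (k + j) = wordRun G (sandRun G s c ω k) (W.take j) := by
  intro j
  induction j with
  | zero => intro _; simp [wordRun]
  | succ j ih =>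
    intro hj
    rw [List.take_succ_eq_append_getElem hj, wordRun_append_singleton, ← ih (by omega), ← hW j hj]
    rfl

theorem sandRun_eq_wordRun (c : SandConfig s) (ω : ℕ → NonSink s) (k : ℕ) :
    sandRun G s c ω k = wordRun G c ((List.range k).map ω) := by
  induction k with
  | zero => rfl
  | succ k ih =>
    rw [List.range_succ, List.map_append, List.map_singleton, wordRun_append_singleton, ← ih]
    rfl

end Toppling

/-! ### Indegree configurations. -/

section Orientations

variable {V : Type*} {G : SimpleGraph V} {O : Digraph V}

theorem IsAcyclicOrientation.exists_minimal [Finite V] (hO : IsAcyclicOrientation O) {A : Set V}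
    (hA : A.Nonempty) : ∃ v ∈ A, ∀ w ∈ A, ¬ O.Adj v w := by
  have : Std.Irrefl (Function.swap (TransGen O.Adj)) := ⟨hO⟩
  have : IsTrans V (Function.swap (TransGen O.Adj)) := ⟨fun _ _ _ h h' => h'.trans h⟩
  obtain ⟨v, hv, hmin⟩ :=
    (Finite.wellFounded_of_trans_of_irrefl (Function.swap (TransGen O.Adj))).has_min A hA
  exact ⟨v, hv, fun w hw h => hmin w hw (.single h)⟩

theorem rootedAcyclicOrientations_exists_adj {s : V} (hO : O ∈ rootedAcyclicOrientations G s)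
    {v : V} (hv : v ≠ s) : ∃ w, O.Adj v w := by
  have : ¬ IsTarget G O v := fun h => hv ((hO.2.2 v).1 h)
  simp only [IsTarget, not_forall] at this
  obtain ⟨w, hw, hwv⟩ := this
  rcases (xor_iff_or_and_not_and _ _).1 (hO.1.2 v w hw) with ⟨h | h, -⟩
  · exact ⟨w, h⟩
  · exact absurd h hwv

open Classical in
/-- The configuration of the indegrees of an orientation. -/
noncomputable def indegConfig [Fintype V] (s : V) (O : Digraph V) : SandConfig s :=
  fun v => (Finset.univ.filter fun w => O.Adj w v).card

variable [Fintype V]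

open Classical in
theorem indegConfig_add_card [DecidableRel G.Adj] {s : V} (hO : IsOrientationOf G O)
    (v : NonSink s) :
    indegConfig s O v + (Finset.univ.filter fun w => O.Adj v w).card = G.degree (v : V) := by
  rw [indegConfig, ← Finset.card_union_of_disjoint, ← G.card_neighborFinset_eq_degree]
  · congr 1
    ext w
    simp only [Finset.mem_union, Finset.mem_filter, Finset.mem_univ, true_and,
      SimpleGraph.mem_neighborFinset]
    constructor
    · rintro (h | h)
      · exact (hO.1 _ _ h).symm
      · exact hO.1 _ _ h
    · exact fun h => ((xor_iff_or_and_not_and _ _).1 (hO.2 _ _ h)).1.symm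
  · rw [Finset.disjoint_filter]
    exact fun w _ h h' => ((xor_iff_or_and_not_and _ _).1 (hO.2 _ _ (hO.1 _ _ h))).2 ⟨h, h'⟩

theorem isStableConfig_indegConfig [DecidableRel G.Adj] {s : V}
    (hO : O ∈ rootedAcyclicOrientations G s) :
    IsStableConfig G s (indegConfig s O) := by
  classical
  intro v
  rw [← indegConfig_add_card hO.1]
  obtain ⟨w, hw⟩ := rootedAcyclicOrientations_exists_adj hO v.2
  exact Nat.lt_add_of_pos_right (Finset.card_pos.2 ⟨w, by simpa using hw⟩)

/-- Among the vertices on edges where `O` and `O'` differ, take `v` with no `O`-arc to another. All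
differing edges at `v` enter it in `O` and leave it in `O'`, so its indegree in `O'` is strictly
smaller. -/
theorem eq_of_indegConfig_le {s : V} {O' : Digraph V} (hO : O ∈ rootedAcyclicOrientations G s)
    (hO' : O' ∈ rootedAcyclicOrientations G s) (h : indegConfig s O ≤ indegConfig s O') :
    O = O' := by
  classical
  have xO : ∀ {v w}, O.Adj v w → ¬ O.Adj w v := fun {v w} h h' =>
    ((xor_iff_or_and_not_and _ _).1 (hO.1.2 _ _ (hO.1.1 _ _ h))).2 ⟨h, h'⟩
  have xO' : ∀ {v w}, O'.Adj v w → ¬ O'.Adj w v := fun {v w} h h' =>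
    ((xor_iff_or_and_not_and _ _).1 (hO'.1.2 _ _ (hO'.1.1 _ _ h))).2 ⟨h, h'⟩
  have tO : ∀ {v w}, G.Adj v w → O.Adj v w ∨ O.Adj w v := fun h =>
    ((xor_iff_or_and_not_and _ _).1 (hO.1.2 _ _ h)).1
  have tO' : ∀ {v w}, G.Adj v w → O'.Adj v w ∨ O'.Adj w v := fun h =>
    ((xor_iff_or_and_not_and _ _).1 (hO'.1.2 _ _ h)).1
  by_contra hne
  set A : Set V := {v | ∃ w, (O.Adj v w ∧ O'.Adj w v) ∨ (O.Adj w v ∧ O'.Adj v w)} with hA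
  have hAne : A.Nonempty := by
    by_contra hempty
    rw [Set.not_nonempty_iff_eq_empty, Set.eq_empty_iff_forall_notMem] at hempty
    refine hne (Digraph.ext ?_)
    ext v w
    have := not_exists.1 (hempty v) w
    constructor
    · intro h
      exact (tO' (hO.1.1 _ _ h)).resolve_right fun h' => this (Or.inl ⟨h, h'⟩)
    · intro h
      exact (tO (hO'.1.1 _ _ h)).resolve_right fun h' => this (Or.inr ⟨h', h⟩)
  obtain ⟨v, ⟨w, hw⟩, hmin⟩ := hO.2.1.exists_minimal hAne
  have hout : ∀ u, O.Adj v u → ¬ O'.Adj u v := fun u h h' =>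
    hmin u ⟨v, Or.inr ⟨h, h'⟩⟩ h
  have hw := hw.resolve_left fun h => hout w h.1 h.2
  have hvs : v ≠ s := by
    rintro rfl
    exact xO' hw.2 ((hO'.2.2 v).2 rfl w (hO'.1.1 _ _ hw.2))
  refine (h ⟨v, hvs⟩).not_gt (Finset.card_lt_card ?_)
  rw [Finset.ssubset_iff_of_subset]
  · exact ⟨w, by simpa using hw.1, by simpa using xO' hw.2⟩
  · intro u hu
    simp only [Finset.mem_filter, Finset.mem_univ, true_and] at hu ⊢
    exact (tO (hO'.1.1 _ _ hu)).resolve_right fun h => hout u h hu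

variable [DecidableEq V] [DecidableRel G.Adj] {s : V}

/-- If `y` arises from the indegree configuration by reverse topplings, it topples back to it. -/
theorem reflTransGen_indegConfig (hO : O ∈ rootedAcyclicOrientations G s) (f : V → ℕ)
    (hf : f s = 0) (y : SandConfig s)
    (hy : ∀ v : NonSink s, y v + ∑ w ∈ G.neighborFinset (v : V), f w =
      indegConfig s O v + G.degree (v : V) * f v) :
    ReflTransGen (ToppleStep G s) y (indegConfig s O) := by
  classical
  induction hk : ∑ v, f v generalizing f y with
  | zero =>
    have h0 : ∀ v, f v = 0 := fun v => (Finset.sum_eq_zero_iff.1 hk) v (Finset.mem_univ v)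
    convert ReflTransGen.refl
    ext v
    simpa [h0] using (hy v).symm
  | succ k ih =>
    -- `f` counts the topplings still to be done. Take `v` with `f` maximal and no arc to another
    -- maximiser: each out-neighbour has smaller `f`, so `y` has at least indegree plus outdegree
    -- grains at `v`, which can topple.
    obtain ⟨v₀, -, hv₀⟩ := Finset.exists_max_image Finset.univ f ⟨s, Finset.mem_univ s⟩
    obtain ⟨v, hv, hmin⟩ := hO.2.1.exists_minimal (A := {v | f v = f v₀}) ⟨v₀, rfl⟩
    rw [Set.mem_ofPred_eq] at hv
    have hle : ∀ w, f w ≤ f v := fun w => hv ▸ hv₀ w (Finset.mem_univ w)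
    have hpos : 0 < f v := by
      by_contra h0
      have : ∑ v, f v = 0 := Finset.sum_eq_zero fun w _ => by have := hle w; omega
      omega
    have hvs : v ≠ s := by rintro rfl; omega
    have hunst : G.degree v ≤ y ⟨v, hvs⟩ := by
      have h1 := hy ⟨v, hvs⟩
      have h2 := indegConfig_add_card hO.1 ⟨v, hvs⟩
      have h3 : ∑ w ∈ G.neighborFinset v, f w + (Finset.univ.filter fun w => O.Adj v w).card ≤
          G.degree v * f v := by
        have : (Finset.univ.filter fun w => O.Adj v w).card =
            ∑ w ∈ G.neighborFinset v, if O.Adj v w then 1 else 0 := by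
          rw [← Finset.card_filter]
          congr 1
          ext w
          simpa using fun h => hO.1.1 _ _ h
        rw [this, ← Finset.sum_add_distrib, ← G.card_neighborFinset_eq_degree, ← smul_eq_mul,
          ← Finset.sum_const]
        refine Finset.sum_le_sum fun w _ => ?_
        split_ifs with h
        · have := hle w
          have : f w ≠ f v := fun h' => hmin w (h'.trans hv) h
          omega
        · exact hle w
      dsimp only at h1 h2
      omega
    refine .head ⟨⟨v, hvs⟩, hunst, rfl⟩ (ih (Function.update f v (f v - 1)) ?_ _ ?_ ?_)
    · rw [Function.update_of_ne hvs.symm, hf]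
    · intro w
      have hsum : ∑ u ∈ G.neighborFinset (w : V), Function.update f v (f v - 1) u +
          (if G.Adj v w then 1 else 0) = ∑ u ∈ G.neighborFinset (w : V), f u := by
        have : (if G.Adj v w then 1 else 0) =
            ∑ u ∈ G.neighborFinset (w : V), if u = v then 1 else 0 := by
          rw [Finset.sum_ite_eq']
          simp [G.adj_comm]
        rw [this, ← Finset.sum_add_distrib]
        refine Finset.sum_congr rfl fun u _ => ?_
        by_cases hu : u = v
        · subst hu
          rw [Function.update_self, if_pos rfl]
          omega
        · rw [Function.update_of_ne hu, if_neg hu, add_zero]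
      have hw := hy w
      by_cases hwv : w = ⟨v, hvs⟩
      · subst hwv
        rw [if_neg G.irrefl, add_zero] at hsum
        rw [topple_apply_self, hsum, Function.update_self, Nat.mul_sub, mul_one]
        have := Nat.le_mul_of_pos_right (G.degree v) hpos
        dsimp only at *
        omega
      · have hwv' : (w : V) ≠ v := fun h => hwv (Subtype.ext h)
        rw [topple_apply_of_ne hwv, Function.update_of_ne hwv']
        dsimp only at *
        omega
    · rw [Finset.sum_update_of_mem (Finset.mem_univ v)]
      have := Finset.add_sum_erase Finset.univ f (Finset.mem_univ v)
      rw [Finset.erase_eq] at this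
      omega

/-- Undoing `M * f v` topplings at each `v`, with `f` strictly superharmonic, adds at least `M`
grains everywhere. For `M` the total of `d`, the result dominates `d`, and `x` is the difference. -/
theorem exists_add_reflTransGen_indegConfig (hG : G.Connected)
    (hO : O ∈ rootedAcyclicOrientations G s) (d : SandConfig s) :
    ∃ x, ReflTransGen (ToppleStep G s) (d + x) (indegConfig s O) := by
  obtain ⟨f, hfs, hf⟩ := exists_superharmonic hG s
  set M := ∑ v, d v
  have key : ∀ v : NonSink s, d v + ∑ w ∈ G.neighborFinset (v : V), M * f w ≤
      indegConfig s O v + G.degree (v : V) * (M * f v) := by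
    intro v
    have h1 : d v ≤ M := Finset.single_le_sum (fun _ _ => Nat.zero_le _) (Finset.mem_univ v)
    have h2 := Nat.mul_le_mul_left M (Nat.succ_le_of_lt (hf v v.2))
    rw [Nat.succ_eq_add_one, mul_add, mul_one, Finset.mul_sum, mul_left_comm] at h2
    omega
  refine ⟨fun v => indegConfig s O v + G.degree (v : V) * (M * f v) -
    (d v + ∑ w ∈ G.neighborFinset (v : V), M * f w),
    reflTransGen_indegConfig hO (fun v => M * f v) (by simp [hfs]) _ fun v => ?_⟩
  have := key v
  simp only [Pi.add_apply]
  omega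

theorem exists_wordRun_eq_indegConfig (hG : G.Connected)
    (hO : O ∈ rootedAcyclicOrientations G s) {d : SandConfig s} (hd : IsStableConfig G s d) :
    ∃ W, wordRun G d W = indegConfig s O := by
  obtain ⟨x, hx⟩ := exists_add_reflTransGen_indegConfig hG hO d
  obtain ⟨W, hW⟩ := exists_word_sum x
  have h := reflTransGen_wordRun hG d W
  rw [hW] at h
  exact ⟨W, IsStabilisation.unique ⟨h, isStableConfig_wordRun hG hd W⟩
    ⟨hx, isStableConfig_indegConfig hO⟩⟩

theorem finite_setOf_isStableConfig : {c : SandConfig s | IsStableConfig G s c}.Finite :=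
  (Set.finite_Iic fun v : NonSink s => G.degree (v : V)).subset fun _ hc v => (hc v).le

/-- One word leads from every stable configuration through the indegree configuration. -/
theorem exists_universal_word (hG : G.Connected) (hO : O ∈ rootedAcyclicOrientations G s) :
    ∃ W : List (NonSink s), ∀ d, IsStableConfig G s d →
      ∃ j ≤ W.length, wordRun G d (W.take j) = indegConfig s O := by
  suffices h : ∀ D : Set (SandConfig s), D.Finite → (∀ d ∈ D, IsStableConfig G s d) →
      ∃ W : List (NonSink s), ∀ d ∈ D, ∃ j ≤ W.length,
        wordRun G d (W.take j) = indegConfig s O from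
    h _ finite_setOf_isStableConfig fun _ => id
  intro D hD
  induction D, hD using Set.Finite.induction_on with
  | empty => exact fun _ => ⟨[], by simp⟩
  | @insert d D _ _ ih =>
    intro h
    obtain ⟨W, hW⟩ := ih fun e he => h e (Or.inr he)
    -- The new word continues `W`, from where `W` leaves `d`; the earlier configurations are already
    -- served by a prefix of `W`.
    obtain ⟨W', hW'⟩ := exists_wordRun_eq_indegConfig hG hO
      (isStableConfig_wordRun hG (h d (Or.inl rfl)) W)
    refine ⟨W ++ W', ?_⟩
    rintro e (rfl | he)
    · refine ⟨(W ++ W').length, le_rfl, ?_⟩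
      rw [List.take_length, wordRun_append, hW']
    · obtain ⟨j, hj, hj'⟩ := hW e he
      refine ⟨j, by rw [List.length_append]; omega, ?_⟩
      rw [List.take_append_of_le_length hj, hj']

/-- If a stable configuration arises from one with only unstable vertices, then it dominates the
indegrees of an orientation, in which the vertices are ordered by their last topplings. -/
theorem exists_indegConfig_le {y c : SandConfig s} (hy : ∀ v : NonSink s, G.degree (v : V) ≤ y v)
    (h : ReflTransGen (ToppleStep G s) y c) (hc : IsStableConfig G s c) :
    ∃ O ∈ rootedAcyclicOrientations G s, indegConfig s O ≤ c := by
  classical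
  -- `ℓ v` is the time of the last toppling of `v`, or 0 if there is none. An untoppled vertex has
  -- lost nothing; a toppled one has since received a grain from every neighbour toppled later.
  have inv : ∃ (ℓ : V → ℕ) (t : ℕ), ℓ s = 0 ∧ (∀ v, ℓ v ≤ t) ∧
      (∀ v w, ℓ v = ℓ w → 0 < ℓ v → v = w) ∧ ∀ v : NonSink s, (ℓ v = 0 → y v ≤ c v) ∧
        (0 < ℓ v → ((G.neighborFinset (v : V)).filter fun w => ℓ v < ℓ w).card ≤ c v) := by
    clear hc hy
    induction h with
    | refl => exact ⟨fun _ => 0, 0, by simp⟩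
    | @tail c c' _ h ih =>
      obtain ⟨ℓ, t, hs, ht, hinj, hℓ⟩ := ih
      obtain ⟨x, hx, rfl⟩ := h
      refine ⟨Function.update ℓ x (t + 1), t + 1, ?_, ?_, ?_, ?_⟩
      · rw [Function.update_of_ne x.2.symm, hs]
      · intro v
        have := ht v
        by_cases hv : v = x
        · rw [hv, Function.update_self]
        · rw [Function.update_of_ne hv]
          omega
      · intro v w hvw hpos
        have h1 := ht v
        have h2 := ht w
        by_cases hv : v = x <;> by_cases hw : w = x
        · rw [hv, hw]
        · rw [hv, Function.update_self, Function.update_of_ne hw] at hvw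
          omega
        · rw [hw, Function.update_self, Function.update_of_ne hv] at hvw
          omega
        · rw [Function.update_of_ne hv, Function.update_of_ne hw] at hvw
          rw [Function.update_of_ne hv] at hpos
          exact hinj v w hvw hpos
      · intro v
        by_cases hv : v = x
        · subst hv
          rw [Function.update_self]
          refine ⟨by omega, fun _ => ?_⟩
          rw [Finset.filter_eq_empty_iff.2]
          · simp
          · intro w _
            by_cases hw : w = v
            · rw [hw, Function.update_self]
              omega
            · rw [Function.update_of_ne hw]
              have := ht w
              omega
        · have hv' : (v : V) ≠ x := fun h => hv (Subtype.ext h)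
          rw [Function.update_of_ne hv', topple_apply_of_ne hv]
          refine ⟨fun h => le_add_right ((hℓ v).1 h), fun h => ?_⟩
          refine le_trans ?_ (Nat.add_le_add_right ((hℓ v).2 h) _)
          split_ifs with hadj
          · refine le_trans (Finset.card_le_card ?_) (Finset.card_insert_le (x : V) _)
            intro w
            simp only [Finset.mem_filter, Finset.mem_insert]
            by_cases hw : w = x
            · exact fun _ => Or.inl hw
            · rw [Function.update_of_ne hw]
              exact Or.inr
          · refine Finset.card_le_card ?_
            intro w
            simp only [Finset.mem_filter, SimpleGraph.mem_neighborFinset]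
            by_cases hw : w = x
            · rintro ⟨h, -⟩
              exact absurd (hw ▸ h).symm hadj
            · rw [Function.update_of_ne hw]
              exact id
  obtain ⟨ℓ, t, hs, -, hinj, hℓ⟩ := inv
  -- An untoppled vertex would still be unstable.
  have hpos : ∀ v, v ≠ s → 0 < ℓ v := fun v hv => Nat.pos_of_ne_zero fun h0 =>
    (((hℓ ⟨v, hv⟩).1 h0).trans_lt (hc ⟨v, hv⟩)).not_ge (hy ⟨v, hv⟩)
  have hinj' : ∀ v w, v ≠ w → ℓ v ≠ ℓ w := fun v w hne h => by
    by_cases hv : v = s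
    · subst hv
      have := hpos w hne.symm
      omega
    · exact hne (hinj v w h (hpos v hv))
  set O : Digraph V := ⟨fun v w => G.Adj v w ∧ ℓ w < ℓ v⟩ with hO
  have hle : indegConfig s O ≤ c := fun v => by
    refine le_trans (Finset.card_le_card ?_) ((hℓ v).2 (hpos v v.2))
    intro w
    simp only [Finset.mem_filter, Finset.mem_univ, true_and, SimpleGraph.mem_neighborFinset, hO]
    exact fun h => ⟨h.1.symm, h.2⟩
  have hor : IsOrientationOf G O := by
    refine ⟨fun v w h => h.1, fun v w h => ?_⟩
    rcases lt_or_gt_of_ne (hinj' v w h.ne) with h' | h'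
    · exact Or.inr ⟨⟨h.symm, h'⟩, fun h'' => lt_asymm h' h''.2⟩
    · exact Or.inl ⟨⟨h, h'⟩, fun h'' => lt_asymm h' h''.2⟩
  refine ⟨O, ⟨hor, ?_, ?_⟩, hle⟩
  · have : ∀ v w, TransGen O.Adj v w → ℓ w < ℓ v := fun v w h => by
      induction h with
      | single h => exact h.2
      | tail _ h ih => exact h.2.trans ih
    exact fun v h => lt_irrefl _ (this v v h)
  · intro v
    constructor
    · intro hv
      by_contra hvs
      have h1 := indegConfig_add_card hor ⟨v, hvs⟩
      have h2 : ∀ w, ¬ O.Adj v w := fun w h => lt_asymm h.2 (hv w h.1).2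
      simp only [h2, Finset.filter_false, Finset.card_empty, add_zero] at h1
      exact ((h1 ▸ hle ⟨v, hvs⟩).trans_lt (hc ⟨v, hvs⟩)).false
    · rintro rfl w hw
      exact ⟨hw.symm, hs ▸ hpos w hw.ne.symm⟩

end Orientations

/-! ### Recurrence in the Markov chain. -/

section Recurrence

open MeasureTheory Filter

/-- In a sequence of independent letters, every word of letters of positive probability occurs
infinitely often. -/
theorem ae_frequently_word {α : Type*} [MeasurableSpace α] [MeasurableSingletonClass α]
    (μ : Measure α) [IsProbabilityMeasure μ] (hμ : ∀ a, 0 < μ {a}) (W : List α) :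
    ∀ᵐ ω ∂(Measure.infinitePi fun _ : ℕ => μ),
      ∃ᶠ k in atTop, ∀ (i : ℕ) (h : i < W.length), ω (k + i) = W[i] := by
  rcases Nat.eq_zero_or_pos W.length with hL | hL
  · refine Eventually.of_forall fun ω => Frequently.of_forall fun k i h => ?_
    omega
  set L := W.length with hLdef
  -- Cut the sequence into disjoint blocks of length `L`. The events that block `k` spells `W` are
  -- independent with the same positive probability, so the second Borel–Cantelli lemma applies.
  set t : ℕ → Set α := fun j => {W[j % L]'(Nat.mod_lt _ hL)} with ht
  set I : ℕ → Finset ℕ := fun k => Finset.Ico (k * L) ((k + 1) * L) with hI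
  set S : ℕ → Set (ℕ → α) := fun k => Set.pi (I k) t with hS
  have hmeas : ∀ J : Finset ℕ, MeasurableSet (Set.pi (J : Set ℕ) t) := fun J =>
    .pi J.countable_toSet fun _ _ => measurableSet_singleton _
  have hprod : ∀ J : Finset ℕ, Measure.infinitePi (fun _ : ℕ => μ) (Set.pi (J : Set ℕ) t) =
      ∏ j ∈ J, μ (t j) := fun J =>
    Measure.infinitePi_pi _ fun _ _ => measurableSet_singleton _
  have hdisj : ∀ k l, k ≠ l → Disjoint (I k) (I l) := by
    intro k l hkl
    rw [Finset.disjoint_left]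
    intro j hj hj'
    rw [hI, Finset.mem_Ico] at hj hj'
    rcases lt_or_gt_of_ne hkl with h | h
    · exact absurd (hj.2.trans_le ((Nat.mul_le_mul_right L h).trans hj'.1)) (lt_irrefl _)
    · exact absurd (hj'.2.trans_le ((Nat.mul_le_mul_right L h).trans hj.1)) (lt_irrefl _)
  have hindep : ProbabilityTheory.iIndepSet S (Measure.infinitePi fun _ : ℕ => μ) := by
    rw [ProbabilityTheory.iIndepSet_iff_meas_biInter fun k => hmeas (I k)]
    intro J
    have : ⋂ k ∈ J, S k = Set.pi ((J.biUnion I : Finset ℕ) : Set ℕ) t := by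
      ext ω
      simp only [hS, Set.mem_iInter, Set.mem_pi, Finset.mem_coe, Finset.mem_biUnion]
      exact ⟨fun h j ⟨k, hk, hj⟩ => h k hk j hj, fun h k hk j hj => h j ⟨k, hk, hj⟩⟩
    rw [this, hprod, Finset.prod_biUnion fun k _ l _ hkl => hdisj k l hkl]
    exact Finset.prod_congr rfl fun k _ => (hprod _).symm
  have hconst : ∀ k, Measure.infinitePi (fun _ : ℕ => μ) (S k) =
      ∏ i ∈ Finset.range L, μ (t i) := by
    intro k
    rw [hprod, hI, Finset.prod_Ico_eq_prod_range, Nat.succ_mul, Nat.add_sub_cancel_left]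
    refine Finset.prod_congr rfl fun i _ => ?_
    simp only [ht, Nat.mul_add_mod_self_right]
  have hsum : ∑' k, Measure.infinitePi (fun _ : ℕ => μ) (S k) = ⊤ := by
    simp only [hconst]
    exact ENNReal.tsum_const_eq_top_of_ne_zero
      (Finset.prod_ne_zero_iff.2 fun i _ => (hμ _).ne')
  have hone := ProbabilityTheory.measure_limsup_eq_one (fun k => hmeas (I k)) hindep hsum
  have hae : ∀ᵐ ω ∂(Measure.infinitePi fun _ : ℕ => μ), ω ∈ limsup S atTop :=
    (mem_ae_iff_prob_eq_one (MeasurableSet.measurableSet_limsup fun k => hmeas (I k))).2 hone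
  filter_upwards [hae] with ω hω
  rw [mem_limsup_iff_frequently_mem, frequently_atTop] at hω
  rw [frequently_atTop]
  intro a
  obtain ⟨b, hb, hω⟩ := hω a
  refine ⟨b * L, hb.trans (Nat.le_mul_of_pos_right b hL), fun i hi => ?_⟩
  have := hω (b * L + i) (by
    rw [hI, Finset.coe_Ico, Set.mem_Ico, Nat.succ_mul]
    omega)
  rw [ht, Set.mem_singleton_iff] at this
  rw [this]
  congr 1
  rw [Nat.mul_add_mod_self_right, Nat.mod_eq_of_lt hi]

variable {V : Type*} [Fintype V] [DecidableEq V] {G : SimpleGraph V} [DecidableRel G.Adj] {s : V}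
  {O : Digraph V}

theorem isStableConfig_sandRun (hG : G.Connected) {c : SandConfig s} (hc : IsStableConfig G s c)
    (ω : ℕ → NonSink s) (k : ℕ) : IsStableConfig G s (sandRun G s c ω k) := by
  rw [sandRun_eq_wordRun]
  exact isStableConfig_wordRun hG hc _

theorem exists_le_sum_grain {ω : ℕ → NonSink s} (hω : ∀ v, ∃ᶠ k in atTop, ω k = v)
    (d : SandConfig s) :
    ∃ K, ∀ k ≥ K, d ≤ (((List.range k).map ω).map fun v : NonSink s => grain s (v : V)).sum := by
  set g : ℕ → SandConfig s :=
    fun k => (((List.range k).map ω).map fun v : NonSink s => grain s (v : V)).sum with hg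
  have hsucc : ∀ k, g (k + 1) = g k + grain s (ω k : V) := fun k => by
    simp [hg, List.range_succ]
  have hmono : Monotone g := monotone_nat_of_le_succ fun k => by
    rw [hsucc]
    exact le_self_add
  have h : ∀ v : NonSink s, ∀ m : ℕ, ∃ K, m ≤ g K v := by
    intro v m
    induction m with
    | zero => exact ⟨0, Nat.zero_le _⟩
    | succ m ih =>
      obtain ⟨K, hK⟩ := ih
      obtain ⟨k, hk, hkv⟩ := frequently_atTop.1 (hω v) K
      refine ⟨k + 1, ?_⟩
      have h1 : g K v ≤ g k v := hmono hk v
      rw [hsucc, Pi.add_apply, grain, if_pos (by rw [hkv])]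
      omega
  choose K hK using fun v => h v (d v)
  refine ⟨Finset.univ.sup K, fun k hk v => (hK v).trans (hmono ?_ v)⟩
  exact (Finset.le_sup (Finset.mem_univ v)).trans hk

variable [MeasurableSpace V] [MeasurableSingletonClass V] {μ : Measure (NonSink s)}

/-- The universal word almost surely occurs infinitely often, and whatever the state, reading it
visits the indegree configuration. -/
theorem isRecurrentConfig_indegConfig (hG : G.Connected)
    (hμ : IsEmpty (NonSink s) ∨ IsProbabilityMeasure μ) (hpos : ∀ v : NonSink s, 0 < μ {v})
    (hO : O ∈ rootedAcyclicOrientations G s) : IsRecurrentConfig G s μ (indegConfig s O) := by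
  refine ⟨isStableConfig_indegConfig hO, ?_⟩
  rcases hμ with hμ | hμ
  · exact Eventually.of_forall fun ω => isEmptyElim (ω 0)
  obtain ⟨W, hW⟩ := exists_universal_word hG hO
  filter_upwards [ae_frequently_word μ hpos W] with ω hω
  rw [frequently_atTop] at hω ⊢
  intro a
  obtain ⟨k, hk, hkW⟩ := hω a
  obtain ⟨j, hj, hjW⟩ := hW _
    (isStableConfig_sandRun hG (isStableConfig_indegConfig hO) ω k)
  exact ⟨k + j, by omega, (sandRun_add_eq_wordRun hkW j hj).trans hjW⟩

/-- Take a return to `c` so late that every vertex has received at least its degree. Put on `c` all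
at once, these grains make every vertex unstable, and the result still topples to `c`. -/
theorem IsRecurrentConfig.exists_indegConfig_le (hG : G.Connected)
    (hμ : IsEmpty (NonSink s) ∨ IsProbabilityMeasure μ) (hpos : ∀ v : NonSink s, 0 < μ {v})
    {c : SandConfig s} (hc : IsRecurrentConfig G s μ c) :
    ∃ O ∈ rootedAcyclicOrientations G s, indegConfig s O ≤ c := by
  rcases hμ with hμ | hμ
  · exact _root_.exists_indegConfig_le (fun v => isEmptyElim v) .refl hc.1
  have hall : ∀ᵐ ω ∂(Measure.infinitePi fun _ : ℕ => μ), ∀ v, ∃ᶠ k in atTop, ω k = v := by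
    rw [ae_all_iff]
    intro v
    filter_upwards [ae_frequently_word μ hpos [v]] with ω hω
    exact hω.mono fun k hk => hk 0 (by simp)
  obtain ⟨ω, hω, hωc⟩ := (hall.and hc.2).exists
  obtain ⟨K, hK⟩ := exists_le_sum_grain hω fun v => G.degree (v : V)
  obtain ⟨k, hk, hkc⟩ := frequently_atTop.1 hωc K
  refine _root_.exists_indegConfig_le
    (y := c + (((List.range k).map ω).map fun v : NonSink s => grain s (v : V)).sum) ?_ ?_ hc.1
  · exact fun v => (hK k hk v).trans (Nat.le_add_left _ _)
  · have := reflTransGen_wordRun hG c ((List.range k).map ω)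
    rwa [← sandRun_eq_wordRun, hkc] at this

theorem mem_minRec_iff (hG : G.Connected)
    (hμ : IsEmpty (NonSink s) ∨ IsProbabilityMeasure μ) (hpos : ∀ v : NonSink s, 0 < μ {v})
    {c : SandConfig s} :
    c ∈ minRec G s μ ↔ ∃ O ∈ rootedAcyclicOrientations G s, indegConfig s O = c := by
  constructor
  · intro hc
    obtain ⟨O, hO, hOc⟩ := hc.prop.exists_indegConfig_le hG hμ hpos
    exact ⟨O, hO, hc.eq_of_le (isRecurrentConfig_indegConfig hG hμ hpos hO) hOc⟩
  · rintro ⟨O, hO, rfl⟩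
    refine ⟨isRecurrentConfig_indegConfig hG hμ hpos hO, fun c hc hcO => ?_⟩
    obtain ⟨O', hO', hO'c⟩ := hc.exists_indegConfig_le hG hμ hpos
    rwa [← eq_of_indegConfig_le hO' hO (hO'c.trans hcO)]

/-- The minimal recurrent configurations are the indegree configurations of the rooted acyclic
orientations. -/
noncomputable def minRecEquiv (hG : G.Connected)
    (hμ : IsEmpty (NonSink s) ∨ IsProbabilityMeasure μ) (hpos : ∀ v : NonSink s, 0 < μ {v}) :
    rootedAcyclicOrientations G s ≃ minRec G s μ :=
  Equiv.ofBijective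
    (fun O => ⟨indegConfig s O.1, (mem_minRec_iff hG hμ hpos).2 ⟨O.1, O.2, rfl⟩⟩)
    ⟨fun O O' h => Subtype.ext
      (eq_of_indegConfig_le O.2 O'.2 (congrArg Subtype.val h).le),
    fun c => by
      obtain ⟨O, hO, h⟩ := (mem_minRec_iff hG hμ hpos).1 c.2
      exact ⟨⟨O, hO⟩, Subtype.ext h⟩⟩

end Recurrence

/-! ### Orientations encoded by sets of edges. -/

section OrientedArcs

variable {V ε : Type*} {G : SimpleGraph V} {s : V}

/-- If some vertices could not reach `s`, one of them would have no arc to another such vertex; but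
it has an outgoing arc, not being a target. -/
theorem rootedAcyclic_iff [Finite V] {O : Digraph V} (hO : IsOrientationOf G O) :
    RootedAcyclic s O.Adj O.Adj ↔ O ∈ rootedAcyclicOrientations G s := by
  constructor
  · rintro ⟨h, h'⟩
    refine ⟨hO, fun v hv => ?_, fun v => ⟨fun hv => ?_, ?_⟩⟩
    · obtain ⟨w, hvw, hwv⟩ := TransGen.head'_iff.1 hv
      exact h v w hvw hwv
    · rcases (h' v).cases_head with hvs | ⟨w, hvw, -⟩
      · exact hvs
      · exact absurd (.single (hv w (hO.1 _ _ hvw))) (h v w hvw)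
    · rintro rfl w hw
      rcases (xor_iff_or_and_not_and _ _).1 (hO.2 v w hw) with ⟨hvw | hwv, -⟩
      · exact absurd (h' w) (h v w hvw)
      · exact hwv
  · intro hO
    refine ⟨fun x y hxy hyx => hO.2.1 x (TransGen.head' hxy hyx), ?_⟩
    by_contra hcon
    obtain ⟨v, hv, hmin⟩ := hO.2.1.exists_minimal (A := {v | ¬ ReflTransGen O.Adj v s})
      (not_forall.1 hcon)
    have hvs : v ≠ s := fun h => hv (h ▸ .refl)
    obtain ⟨w, hw⟩ := rootedAcyclicOrientations_exists_adj hO hvs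
    exact hmin w (fun hws => hv (.head hw hws)) hw

variable {a b : ε → V} {E : Finset ε}

/-- `hinj` and `hab` exclude parallel edges, and `hab` with `f = g` excludes loops. -/
theorem isOrientationOf_orientedArcs (hG : ∀ v w, G.Adj v w ↔ edgeLinks a b E v w)
    (hinj : ∀ f ∈ E, ∀ g ∈ E, a f = a g → b f = b g → f = g)
    (hab : ∀ f ∈ E, ∀ g ∈ E, a f = b g → b f ≠ a g) (σ : Finset ε) :
    IsOrientationOf G ⟨orientedArcs a b E σ⟩ := by
  constructor
  · rintro v w ⟨f, hf, h⟩
    exact (hG v w).2 ⟨f, hf, by tauto⟩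
  · intro v w h
    rw [xor_iff_or_and_not_and]
    constructor
    · obtain ⟨f, hf, ⟨rfl, rfl⟩ | ⟨rfl, rfl⟩⟩ := (hG v w).1 h
      · by_cases hσ : f ∈ σ
        · exact Or.inl ⟨f, hf, Or.inl ⟨hσ, rfl, rfl⟩⟩
        · exact Or.inr ⟨f, hf, Or.inr ⟨hσ, rfl, rfl⟩⟩
      · by_cases hσ : f ∈ σ
        · exact Or.inr ⟨f, hf, Or.inl ⟨hσ, rfl, rfl⟩⟩
        · exact Or.inl ⟨f, hf, Or.inr ⟨hσ, rfl, rfl⟩⟩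
    · rintro ⟨⟨f, hf, ⟨hσ, rfl, rfl⟩ | ⟨hσ, rfl, rfl⟩⟩, g, hg, ⟨hσ', h1, h2⟩ | ⟨hσ', h1, h2⟩⟩
      · exact hab f hf g hg h2 h1
      · exact hσ' (hinj f hf g hg h2 h1 ▸ hσ)
      · exact hσ (hinj f hf g hg h1 h2 ▸ hσ')
      · exact hab f hf g hg h1 h2

theorem orientedArcs_iff_mem (hinj : ∀ f ∈ E, ∀ g ∈ E, a f = a g → b f = b g → f = g)
    (hab : ∀ f ∈ E, ∀ g ∈ E, a f = b g → b f ≠ a g) {σ : Finset ε} {f : ε} (hf : f ∈ E) :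
    orientedArcs a b E σ (a f) (b f) ↔ f ∈ σ := by
  constructor
  · rintro ⟨g, hg, ⟨h, h1, h2⟩ | ⟨-, h1, h2⟩⟩
    · exact hinj f hf g hg h1 h2 ▸ h
    · exact absurd h2 (hab f hf g hg h1)
  · exact fun h => ⟨f, hf, Or.inl ⟨h, rfl, rfl⟩⟩

open Classical in
/-- Rooted acyclic orientations, encoded by the sets of the edges `f` directed from `a f` to
`b f`. -/
noncomputable def rootedAcyclicEquiv [Finite V] (hG : ∀ v w, G.Adj v w ↔ edgeLinks a b E v w)
    (hinj : ∀ f ∈ E, ∀ g ∈ E, a f = a g → b f = b g → f = g)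
    (hab : ∀ f ∈ E, ∀ g ∈ E, a f = b g → b f ≠ a g) :
    {σ // σ ∈ E.powerset.filter fun σ =>
      RootedAcyclic s (orientedArcs a b E σ) (⊥ ⊔ orientedArcs a b E σ)} ≃
      rootedAcyclicOrientations G s :=
  Equiv.ofBijective
    (fun σ => ⟨⟨orientedArcs a b E σ.1⟩, by
      have := (Finset.mem_filter.1 σ.2).2
      rw [bot_sup_eq] at this
      exact (rootedAcyclic_iff (isOrientationOf_orientedArcs hG hinj hab σ.1)).1 this⟩)
    ⟨by
      intro σ σ' h
      have h : orientedArcs a b E σ.1 = orientedArcs a b E σ'.1 :=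
        congrArg Digraph.Adj (congrArg Subtype.val h)
      have hσ := Finset.mem_powerset.1 (Finset.mem_filter.1 σ.2).1
      have hσ' := Finset.mem_powerset.1 (Finset.mem_filter.1 σ'.2).1
      refine Subtype.ext (Finset.ext fun f => ?_)
      by_cases hf : f ∈ E
      · rw [← orientedArcs_iff_mem hinj hab hf, h, orientedArcs_iff_mem hinj hab hf]
      · exact iff_of_false (fun h => hf (hσ h)) (fun h => hf (hσ' h)),
    by
      rintro ⟨O, hO⟩
      have hadj : orientedArcs a b E (E.filter fun f => O.Adj (a f) (b f)) = O.Adj := by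
        ext v w
        constructor
        · rintro ⟨f, hf, ⟨h, rfl, rfl⟩ | ⟨h, rfl, rfl⟩⟩
          · exact (Finset.mem_filter.1 h).2
          · have hG' : G.Adj (a f) (b f) := (hG _ _).2 ⟨f, hf, Or.inl ⟨rfl, rfl⟩⟩
            exact (((xor_iff_or_and_not_and _ _).1 (hO.1.2 _ _ hG')).1).resolve_left
              fun h' => h (Finset.mem_filter.2 ⟨hf, h'⟩)
        · intro h
          obtain ⟨f, hf, ⟨rfl, rfl⟩ | ⟨rfl, rfl⟩⟩ := (hG v w).1 (hO.1.1 _ _ h)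
          · exact ⟨f, hf, Or.inl ⟨Finset.mem_filter.2 ⟨hf, h⟩, rfl, rfl⟩⟩
          · refine ⟨f, hf, Or.inr ⟨fun h' => ?_, rfl, rfl⟩⟩
            exact ((xor_iff_or_and_not_and _ _).1 (hO.1.2 _ _ (hO.1.1 _ _ h))).2
              ⟨h, (Finset.mem_filter.1 h').2⟩
      refine ⟨⟨E.filter fun f => O.Adj (a f) (b f), Finset.mem_filter.2
        ⟨Finset.mem_powerset.2 (Finset.filter_subset _ _), ?_⟩⟩,
        Subtype.ext (Digraph.ext hadj)⟩
      rw [bot_sup_eq, hadj]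
      exact (rootedAcyclic_iff hO.1).2 hO⟩

end OrientedArcs

/-! ### Connectedness of the permutation graph, and conclusion. -/

section PermGraph

variable {n : ℕ} {π : Equiv.Perm (Fin n)}

theorem permGraph_adj_iff (v w : Fin n) :
    (permGraph π).Adj v w ↔ edgeLinks rowLetter (colLetter π) (inversionCells π) v w := by
  have h : ∀ v w, IsInversion π w v ↔
      ∃ f ∈ inversionCells π, v = rowLetter f ∧ w = colLetter π f := by
    intro v w
    constructor
    · intro h
      refine ⟨toLex (v, π.symm w), mem_inversionCells.2 ⟨?_, h.2⟩, rfl, ?_⟩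
      · rw [π.apply_symm_apply]
        exact h.1
      · exact (π.apply_symm_apply w).symm
    · rintro ⟨f, hf, rfl, rfl⟩
      have := mem_inversionCells.1 hf
      refine ⟨this.1, ?_⟩
      rw [colLetter, π.symm_apply_apply]
      exact this.2
  change IsInversion π v w ∨ IsInversion π w v ↔ _
  rw [h, h, edgeLinks, or_comm, ← exists_or]
  refine exists_congr fun f => ?_
  tauto

/-- Some letter at least `k` stands among the first `k` positions, so by counting some letter below
`k` stands after them. -/
theorem exists_inversion_of_permIrreducible (hπ : PermIrreducible π) {k : ℕ} (hk : 1 ≤ k)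
    (hkn : k < n) : ∃ i j : Fin n, (j : ℕ) < k ∧ k ≤ i ∧ IsInversion π i j := by
  have h1 : ∃ p : Fin n, (p : ℕ) < k ∧ k ≤ π p := by
    by_contra! h
    exact hπ ⟨k, hk, hkn, h⟩
  obtain ⟨p, hp, hpk⟩ := h1
  have h2 : ∃ q : Fin n, k ≤ (q : ℕ) ∧ (π q : ℕ) < k := by
    by_contra! h
    have := Equiv.Perm.perm_symm_mapsTo_of_mapsTo π (s := {q : Fin n | k ≤ (q : ℕ)}) h
      (show π p ∈ {q : Fin n | k ≤ (q : ℕ)} from hpk)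
    rw [π.symm_apply_apply] at this
    exact absurd hp (not_lt.2 this)
  obtain ⟨q, hq, hqk⟩ := h2
  refine ⟨π p, π q, hqk, hpk, Fin.lt_def.2 (hqk.trans_le hpk), ?_⟩
  rw [π.symm_apply_apply, π.symm_apply_apply]
  exact Fin.lt_def.2 (hp.trans_le hq)

/-- A letter strictly between `j` and `i` is either to the right of `i`, hence adjacent to `i`, or
to the left of `i` and so of `j`, hence adjacent to `j`. -/
theorem IsInversion.reachable {i j x : Fin n} (h : IsInversion π i j) (hj : j ≤ x) (hi : x ≤ i) :
    (permGraph π).Reachable i x := by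
  have hij : (permGraph π).Adj i j := Or.inl h
  rcases hi.eq_or_lt with rfl | hi
  · exact .refl _
  rcases hj.eq_or_lt with rfl | hj
  · exact hij.reachable
  rcases lt_or_gt_of_ne (show π.symm i ≠ π.symm x from fun h => hi.ne (π.symm.injective h).symm)
    with hx | hx
  · exact SimpleGraph.Adj.reachable (Or.inl ⟨hi, hx⟩)
  · exact hij.reachable.trans (SimpleGraph.Adj.reachable (Or.inr ⟨hj, hx.trans h.2⟩))

theorem permGraph_connected (hπ : PermIrreducible π) (s : Fin n) : (permGraph π).Connected := by
  have h0 : ∀ (k : ℕ) (hk : k < n), (permGraph π).Reachable ⟨0, s.pos⟩ ⟨k, hk⟩ := by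
    intro k
    induction k with
    | zero => exact fun _ => .refl _
    | succ k ih =>
      intro hk
      -- Both `k` and `k + 1` lie between the letters of an inversion across this cut.
      obtain ⟨i, j, hj, hi, hij⟩ := exists_inversion_of_permIrreducible hπ (Nat.succ_pos k) hk
      have h1 : (permGraph π).Reachable i ⟨k, by omega⟩ :=
        hij.reachable (Fin.le_def.2 (by simp; omega)) (Fin.le_def.2 (by simp; omega))
      have h2 : (permGraph π).Reachable i ⟨k + 1, hk⟩ :=
        hij.reachable (Fin.le_def.2 (by simp; omega)) (Fin.le_def.2 hi)
      exact (ih _).trans (h1.symm.trans h2)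
  have : Nonempty (Fin n) := ⟨s⟩
  exact ⟨fun u v => (h0 u u.2).symm.trans (h0 v v.2)⟩

theorem nonempty_cnatSet_equiv (π : Equiv.Perm (Fin n)) (s : Fin n) :
    Nonempty (cnatSet π ≃ rootedAcyclicOrientations (permGraph π) s) := by
  classical
  have hcard := sum_rootedAcyclic_eq_sum_isConnectedNBC (a := rowLetter) (b := colLetter π) s
    (inversionCells π) ⊥ (fun _ _ h => h)
  rw [← Finset.card_filter, ← Finset.card_filter] at hcard
  refine ⟨(cnatEquiv π s).trans ((Finset.equivOfCardEq hcard.symm).trans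
    (rootedAcyclicEquiv permGraph_adj_iff ?_ ?_))⟩
  · intro f _ g _ h1 h2
    exact ofLex.injective (Prod.ext h1 (π.injective h2))
  · intro f hf g hg h1 h2
    have h3 : rowLetter f < colLetter π f := (mem_inversionCells.1 hf).1
    have h4 : rowLetter g < colLetter π g := (mem_inversionCells.1 hg).1
    rw [h1, h2] at h3
    exact lt_asymm h3 h4

end PermGraph

theorem mainTheorem1 (n : ℕ) (π : Equiv.Perm (Fin n)) (hπ : PermIrreducible π) (s : Fin n)
    (μ : MeasureTheory.Measure (NonSink s))
    (hμ : 1 < n → MeasureTheory.IsProbabilityMeasure μ)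
    (hpos : ∀ v : NonSink s, 0 < μ {v}) :
    Nonempty (cnatSet π ≃ minRec (permGraph π) s μ) ∧
      Nonempty (minRec (permGraph π) s μ ≃ rootedAcyclicOrientations (permGraph π) s) ∧
      Nonempty (cnatSet π ≃ rootedAcyclicOrientations (permGraph π) s) := by
  -- For `n = 1` there is no non-sink vertex, and an empty type carries no probability measure.
  have hμ' : IsEmpty (NonSink s) ∨ MeasureTheory.IsProbabilityMeasure μ := by
    rcases Nat.lt_or_ge 1 n with hn | hn
    · exact Or.inr (hμ hn)
    · exact Or.inl ⟨fun v => v.2 (Fin.ext (by have := v.1.2; have := s.2; omega))⟩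
  have e := minRecEquiv (permGraph_connected hπ s) hμ' hpos
  obtain ⟨e'⟩ := nonempty_cnatSet_equiv π s
  exact ⟨⟨e'.trans e⟩, ⟨e.symm⟩, ⟨e'⟩⟩
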